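/- **Setting.** Let $K$ be an infinite field, $\Gamma$ a finite quiver, $I$ an admissible ideal of the path algebra $K\Gamma$ (that is, $R^N\subseteq I\subseteq R^2$ for some $N\ge 2$, where $R$ is the ideal generated by the arrows), and $\Lambda=K\Gamma/I$, with Jacobson radical $J$. Write $qp$ for "$q$ after $p$"; a right subpath of a path $p$ is a path $u$ with $p=u'u$ for some path $u'$. A module is uniserial if its submodules form a chain. A path $p$ of length $l$ is a mast of a uniserial left $\Lambda$-module $U$ if $U$ has composition length $l+1$ and $pU\neq 0$. A top element of $U$ is an element $x\in U\setminus JU$ with $x=ex$ for some vertex $e$. A detour on $p$ is a pair $(\alpha,u)$ with $u$ a right subpath of $p$ and $\alpha$ an arrow such that $\alpha u$ is a path which is not a right subpath of $p$, while some right subpath of $p$ strictly longer than $u$ ends in the same vertex as $\alpha$; let $(v_i(\alpha,u))_{i\in I(\alpha,u)}$ be the family of all right subpaths of the latter kind. Let $V_p$ be the affine variety of all points $(k_i(\alpha,u))$, with coordinates in $K$ indexed by the detours $(\alpha,u)$ on $p$ and $i\in I(\alpha,u)$, for which there are a uniserial left $\Lambda$-module $U$ with mast $p$ and a top element $x$ of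 $U$ such that $\alpha ux=\sum_i k_i(\alpha,u)\,v_i(\alpha,u)x$ for all detours $(\alpha,u)$. Let $A_p$ be its coordinate ring (the polynomials in the variables $X_i(\alpha,u)$ modulo those vanishing on $V_p$). A detour $(\alpha,u)$ is a halyard on $p$ if some $X_i(\alpha,u)$ has nonzero image in $A_p$; a halyard is slack if some $X_i(\alpha,u)$ has image in $A_p$ transcendental over $K$, and tight otherwise. Condition (N): whenever $\alpha:e\to e'$ is an arrow and $p:e\to e'$ is a path of positive length which is a mast of some uniserial left $\Lambda$-module, then $p\in K\Gamma\alpha\cup\alpha K\Gamma$ (that is, $p$ starts in $\alpha$ or ends in $\alpha$). **Theorem 5.1.** Assume that $\Lambda$ satisfies (N). Let $\mathbb S=(S(0),\dots,S(l))$ be a sequence of simple left $\Lambda$-modules with $\operatorname{Ext}^1_\Lambda(S(0),S(0))\neq 0$ such that $V_{\mathbb S}\neq\varnothing$, i.e. such that $V_p\ne\varnothing$ for some path $p$ of length $l$ passing through the vertices corresponding to $S(0),\dots,S(l)$ in this order. Then there is exactly one path $p$ of length $l$ passing through these vertices in this order, and the following conditions are equivalent: (1) There are only finitely many isomorphism types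 of uniserial left $\Lambda$-modules with composition series $\mathbb S$ (that is, with consecutive composition factors $S(0),\dots,S(l)$ from the top to the socle). (2) The path $p$ has the form $$e\xrightarrow{\gamma}e\xrightarrow{\gamma}\cdots\xrightarrow{\gamma}e\xrightarrow{\alpha}e_1\to e_2\to\cdots\to e_\nu ,$$ that is, $\gamma^\mu$ for a loop $\gamma$ at a vertex $e$, followed (if $\nu\ge1$) by an arrow $\alpha:e\to e_1$ and a path through $e_1,\dots,e_\nu$, where $\mu,\nu\ge0$, $\mu+\nu=l$ and $e\notin\{e_1,\dots,e_\nu\}$; if $\mu\ge1$ and $\nu\ge2$, then $e_1\notin\{e_2,\dots,e_\nu\}$. Moreover, the only slack halyards on $p$ are of the form $(\alpha,\gamma^i)$ with $0\le i\le\mu-1$ (so there are none if $\mu=0$ or $\nu=0$). If (2) is satisfied and there are no tight halyards on $p$, then there exists, up to isomorphism, precisely one uniserial left $\Lambda$-module with composition series $\mathbb S$. -/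

import Mathlib

universe u v w

/-! ### Paths and the path algebra of a finite quiver -/

/-- A path of a quiver together with its initial vertex and its terminal vertex. -/
structure QuiverPath (V : Type v) [Quiver.{w} V] where
  src : V
  tgt : V
  path : Quiver.Path src tgt

/-- The underlying vector space of the path algebra `KΓ`: its basis is the set of all paths,
including the paths of length zero. -/
def PathAlgebra (K : Type u) (V : Type v) [Field K] [Quiver.{w} V] :
    Type (max u v w) :=
  QuiverPath V →₀ K

namespace PathAlgebra

noncomputable section

variable {K : Type u} {V : Type v} [Field K] [Quiver.{w} V]

instance : AddCommGroup (PathAlgebra K V) := inferInstanceAs (AddCommGroup (QuiverPath V →₀ K))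

instance : Module K (PathAlgebra K V) := inferInstanceAs (Module K (QuiverPath V →₀ K))

variable (K) in
/-- A path, viewed as a basis element of the path algebra. -/
def of (p : QuiverPath V) : PathAlgebra K V := Finsupp.single p (1 : K)

/-- The linear extension of a map defined on paths. -/
def lift {M : Type*} [AddCommGroup M] [Module K M] (f : QuiverPath V → M) :
    PathAlgebra K V →ₗ[K] M :=
  Finsupp.lift M K (QuiverPath V) f

theorem lift_of {M : Type*} [AddCommGroup M] [Module K M] (f : QuiverPath V → M)
    (p : QuiverPath V) : lift f (of K p) = f p := by
  have h : Finsupp.lift M K (QuiverPath V) f (Finsupp.single p (1 : K)) = f p := by simp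
  exact h


theorem hom_ext {M : Type*} [AddCommMonoid M] [Module K M] {f g : PathAlgebra K V →ₗ[K] M}
    (h : ∀ p, f (of K p) = g (of K p)) : f = g :=
  Finsupp.lhom_ext' fun p => LinearMap.ext_ring (h p)

theorem induction_linear {P : PathAlgebra K V → Prop} (x : PathAlgebra K V) (zero : P 0)
    (add : ∀ f g, P f → P g → P (f + g)) (smul_of : ∀ (t : K) (p : QuiverPath V), P (t • of K p)) :
    P x :=
  Finsupp.induction_linear (motive := P) x zero add fun p t => by
    have h : t • Finsupp.single p (1 : K) = Finsupp.single p t := by simp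
    exact h ▸ smul_of t p

open Classical in
/-- The product `qp` ("`q` after `p`") of two paths: their concatenation if `p` ends where `q`
starts, and `0` otherwise. -/
def mulPath (q p : QuiverPath V) : PathAlgebra K V :=
  if h : p.tgt = q.src then of K ⟨p.src, q.tgt, (p.path.cast rfl h).comp q.path⟩ else 0

variable (K V) in
/-- The bilinear extension of the product of paths. -/
def mulLin : PathAlgebra K V →ₗ[K] PathAlgebra K V →ₗ[K] PathAlgebra K V :=
  lift fun q => lift fun p => mulPath q p

instance : Mul (PathAlgebra K V) := ⟨fun x y => mulLin K V x y⟩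

theorem mul_def (x y : PathAlgebra K V) : x * y = mulLin K V x y := rfl

theorem of_mul_of (q p : QuiverPath V) : of K q * of K p = mulPath q p := by
  rw [mul_def, mulLin, lift_of, lift_of]

theorem of_mul_of_comp {a b c : V} (q : Quiver.Path b c) (p : Quiver.Path a b) :
    of K ⟨b, c, q⟩ * of K ⟨a, b, p⟩ = of K ⟨a, c, p.comp q⟩ := by
  rw [of_mul_of, mulPath, dif_pos rfl]
  rfl

theorem of_mul_of_ne {q p : QuiverPath V} (h : p.tgt ≠ q.src) : of K q * of K p = 0 := by
  rw [of_mul_of, mulPath, dif_neg h]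

theorem mul_assoc_of (r q p : QuiverPath V) :
    of K r * of K q * of K p = of K r * (of K q * of K p) := by
  obtain ⟨c, d, r⟩ := r
  obtain ⟨b, c', q⟩ := q
  obtain ⟨a, b', p⟩ := p
  have zl (x : PathAlgebra K V) : 0 * x = 0 := by simp [mul_def]
  have zr (x : PathAlgebra K V) : x * 0 = 0 := by simp [mul_def]
  by_cases h1 : c' = c
  · subst h1
    by_cases h2 : b' = b
    · subst h2
      simp only [of_mul_of_comp, Quiver.Path.comp_assoc]
    · rw [of_mul_of_comp, of_mul_of_ne (q := ⟨b, c', q⟩) h2, of_mul_of_ne h2, zr]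
  · rw [of_mul_of_ne (q := ⟨c, d, r⟩) (p := ⟨b, c', q⟩) h1, zl]
    by_cases h2 : b' = b
    · subst h2
      rw [of_mul_of_comp, of_mul_of_ne h1]
    · rw [of_mul_of_ne (q := ⟨b, c', q⟩) h2, zr]

theorem mul_assoc_aux (x y z : PathAlgebra K V) : x * y * z = x * (y * z) := by
  have key : ∀ r q p : QuiverPath V, mulLin K V (mulLin K V (of K r) (of K q)) (of K p) =
      mulLin K V (of K r) (mulLin K V (of K q) (of K p)) := mul_assoc_of
  simp only [mul_def]
  induction x using induction_linear with
  | zero => simp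
  | add f g hf hg => simp [hf, hg]
  | smul_of a r =>
    induction y using induction_linear with
    | zero => simp
    | add f g hf hg => simpa using congrArg₂ (· + ·) hf hg
    | smul_of b q =>
      induction z using induction_linear with
      | zero => simp
      | add f g hf hg => simp only [map_add, hf, hg]
      | smul_of c p => simp only [map_smul, LinearMap.smul_apply, key]

/-- The path of length zero at a vertex; these are the distinguished primitive idempotents. -/
def vertex (K : Type u) [Field K] (e : V) : PathAlgebra K V := of K ⟨e, e, Quiver.Path.nil⟩

variable [Fintype V]

instance : One (PathAlgebra K V) := ⟨∑ e : V, vertex K e⟩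

theorem one_def : (1 : PathAlgebra K V) = ∑ e : V, vertex K e := rfl

instance : Ring (PathAlgebra K V) where
  __ := (inferInstance : AddCommGroup (PathAlgebra K V))
  left_distrib x y z := by simp [mul_def]
  right_distrib x y z := by simp [mul_def]
  zero_mul x := by simp [mul_def]
  mul_zero x := by simp [mul_def]
  mul_assoc x y z := by
    exact mul_assoc_aux x y z
  one_mul x := by
    have h : mulLin K V 1 = LinearMap.id := by
      refine hom_ext fun p => ?_
      rw [one_def, map_sum, LinearMap.sum_apply, Finset.sum_eq_single p.tgt]
      · exact (of_mul_of_comp (K := K) Quiver.Path.nil p.path)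
      · intro e _ he
        exact of_mul_of_ne (q := ⟨e, e, Quiver.Path.nil⟩) he.symm
      · simp
    exact congrArg (fun f => f x) h
  mul_one x := by
    have h : (mulLin K V).flip 1 = LinearMap.id := by
      refine hom_ext fun p => ?_
      rw [LinearMap.flip_apply, one_def, map_sum, Finset.sum_eq_single p.src]
      · exact (of_mul_of_comp (K := K) p.path Quiver.Path.nil).trans (by simp)
      · intro e _ he
        exact of_mul_of_ne (p := ⟨e, e, Quiver.Path.nil⟩) he
      · simp
    exact congrArg (fun f => f x) h

instance : Algebra K (PathAlgebra K V) :=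
  Algebra.ofModule (fun r x y => by simp [mul_def]) (fun r x y => by simp [mul_def])

end

end PathAlgebra

/-! ### Admissible ideals -/

/-- The `m`-th power of the ideal generated by the arrows: the span of the paths of length at
least `m`. -/
noncomputable def arrowPower (K : Type u) (V : Type v) [Field K] [Quiver.{w} V] (m : ℕ) :
    Submodule K (PathAlgebra K V) :=
  Submodule.span K {x | ∃ p : QuiverPath V, m ≤ p.path.length ∧ x = PathAlgebra.of K p}

/-- An ideal `I` of the path algebra is admissible if `R ^ N ⊆ I ⊆ R ^ 2` for some `N ≥ 2`, where
`R` is the ideal generated by the arrows. -/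
def IsAdmissible {K : Type u} {V : Type v} [Field K] [Quiver.{w} V] [Fintype V]
    (I : Ideal (PathAlgebra K V)) : Prop :=
  (∃ N : ℕ, 2 ≤ N ∧ ∀ x ∈ arrowPower K V N, x ∈ I) ∧ ∀ x ∈ I, x ∈ arrowPower K V 2

/-! ### Uniserial modules -/

/-- A module is uniserial if its submodules form a chain. -/
def IsUniserial (R : Type*) [Ring R] (U : Type*) [AddCommGroup U] [Module R U] : Prop :=
  ∀ M N : Submodule R U, M ≤ N ∨ N ≤ M

/-- `U` is a uniserial module with sequence `S 0, …, S l` of consecutive composition factors,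
listed from the top to the socle. -/
def IsUniserialWithFactors {R : Type u} [Ring R] {l : ℕ} (S : Fin (l + 1) → ModuleCat.{v} R)
    (U : Type v) [AddCommGroup U] [Module R U] : Prop :=
  IsUniserial R U ∧ ∃ F : Fin (l + 2) → Submodule R U,
    Antitone F ∧ F 0 = ⊤ ∧ F (Fin.last (l + 1)) = ⊥ ∧
      ∀ i : Fin (l + 1),
        Nonempty ((F i.castSucc ⧸ (F i.succ).submoduleOf (F i.castSucc)) ≃ₗ[R] S i)

/-- The set of isomorphism types of uniserial modules with composition series `S 0, …, S l`. -/
def uniserialTypes {R : Type u} [Ring R] {l : ℕ} (S : Fin (l + 1) → ModuleCat.{v} R) :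
    Set (Quotient (CategoryTheory.isIsomorphicSetoid (ModuleCat.{v} R))) :=
  {c | ∃ U : ModuleCat.{v} R, IsUniserialWithFactors S U ∧ Quotient.mk _ U = c}

/-! ### Detours on a path -/

section Detours

variable {V : Type v} [Quiver.{w} V]

/-- `u` is a right subpath of `p`, i.e. `p = u' u` for some path `u'`. (Here `u.comp u'` stands for
"`u'` after `u`".) -/
def IsRightSubpath {a b c : V} (u : Quiver.Path a c) (p : Quiver.Path a b) : Prop :=
  ∃ u' : Quiver.Path c b, p = u.comp u'

/-- A pair `(α, u)` consisting of a path `u` starting at `a` and an arrow `α` which starts where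
`u` ends. -/
structure ArrowAfterPath (a : V) where
  {mid tgt : V}
  arrow : mid ⟶ tgt
  stem : Quiver.Path a mid

/-- The pair `(α, u)` is a detour on `p`: `u` is a right subpath of `p`, `α u` is not a right
subpath of `p`, but some right subpath `v` of `p` strictly longer than `u` ends in the same vertex
as `α`. -/
def IsDetour {a b : V} (p : Quiver.Path a b) (d : ArrowAfterPath a) : Prop :=
  IsRightSubpath d.stem p ∧ ¬ IsRightSubpath (d.stem.cons d.arrow) p ∧
    ∃ v : Quiver.Path a d.tgt, IsRightSubpath v p ∧ d.stem.length < v.length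

/-- The detours on `p`. -/
abbrev Detour {a b : V} (p : Quiver.Path a b) : Type (max v w) :=
  {d : ArrowAfterPath a // IsDetour p d}

/-- The index set `I(α, u)`: all right subpaths of `p` which are strictly longer than `u` and end in
the same vertex as `α`. -/
abbrev DetourIndex {a b : V} {p : Quiver.Path a b} (d : Detour p) : Type (max v w) :=
  {v : Quiver.Path a d.1.tgt // IsRightSubpath v p ∧ d.1.stem.length < v.length}

instance {a b : V} {p : Quiver.Path a b} (d : Detour p) : Finite (DetourIndex d) := by
  refine Finite.of_injective (β := Fin (p.length + 1)) (fun v => ⟨v.1.length, ?_⟩) ?_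
  · obtain ⟨u', h⟩ := v.2.1
    have := congrArg Quiver.Path.length h
    rw [Quiver.Path.length_comp] at this
    omega
  · rintro ⟨v, ⟨v', hv⟩, _⟩ ⟨z, ⟨z', hz⟩, _⟩ h
    have hl : v.length = z.length := congrArg Fin.val h
    exact Subtype.ext ((Quiver.Path.comp_inj' hl).1 (hv.symm.trans hz)).1

noncomputable instance {a b : V} {p : Quiver.Path a b} (d : Detour p) :
    Fintype (DetourIndex d) :=
  Fintype.ofFinite _

/-- The variables `X_i(α, u)`: one for each detour `(α, u)` on `p` and each `i ∈ I(α, u)`. -/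
abbrev DetourVar {a b : V} (p : Quiver.Path a b) : Type (max v w) :=
  Σ d : Detour p, DetourIndex d

/-- The power `γ ^ m` of a loop. -/
def loopPow {e : V} (γ : e ⟶ e) : ℕ → Quiver.Path e e
  | 0 => Quiver.Path.nil
  | m + 1 => (loopPow γ m).cons γ

end Detours

/-! ### Masts, the varieties of uniserial modules, and halyards -/

section Varieties

variable {K : Type u} {V : Type v} [Field K] [Quiver.{w} V] [Fintype V]
  (I : Ideal (PathAlgebra K V)) [I.IsTwoSided]

/-- The residue class in `Λ = KΓ / I` of a path. -/
noncomputable def pathClass {a b : V} (p : Quiver.Path a b) : PathAlgebra K V ⧸ I :=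
  Ideal.Quotient.mk I (PathAlgebra.of K ⟨a, b, p⟩)

/-- The path `p` is a mast of `U`: the module `U` is uniserial, of composition length
`length p + 1`, and `p U ≠ 0`. -/
def IsMastOf {a b : V} (p : Quiver.Path a b) (U : Type*) [AddCommGroup U]
    [Module (PathAlgebra K V ⧸ I) U] : Prop :=
  IsUniserial (PathAlgebra K V ⧸ I) U ∧
    Module.length (PathAlgebra K V ⧸ I) U = (p.length + 1 : ℕ) ∧
    ∃ x : U, pathClass I p • x ≠ 0

/-- The path `p` is a mast of some uniserial left `Λ`-module. -/
def IsMast {a b : V} (p : Quiver.Path a b) : Prop :=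
  ∃ U : ModuleCat.{max u v w} (PathAlgebra K V ⧸ I), IsMastOf I p U

/-- A top element of `U`: an element outside `J U` which is fixed by one of the distinguished
idempotents, where `J` is the Jacobson radical of `Λ`. -/
def IsTopElement {U : Type*} [AddCommGroup U] [Module (PathAlgebra K V ⧸ I) U] (x : U) : Prop :=
  x ∉ Ring.jacobson (PathAlgebra K V ⧸ I) • (⊤ : Submodule (PathAlgebra K V ⧸ I) U) ∧
    ∃ e : V, pathClass I (Quiver.Path.nil : Quiver.Path e e) • x = x

/-- Condition (N): whenever `α : e ⟶ e'` is an arrow and `p` is a mast of positive length from `e`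
to `e'`, the path `p` starts in `α` or ends in `α`. -/
def ConditionN : Prop :=
  ∀ (e e' : V) (α : e ⟶ e') (p : Quiver.Path e e'), 0 < p.length → IsMast I p →
    (∃ c' : Quiver.Path e' e', p = α.toPath.comp c') ∨
      ∃ c : Quiver.Path e e, p = c.comp α.toPath

/-- The affine variety `V_p`: the points `(k_i(α, u))` for which there are a uniserial module `U`
with mast `p` and a top element `x` of `U` such that `α u x = ∑ i, k_i(α, u) v_i(α, u) x` for all
detours `(α, u)` on `p`. -/
def uniserialVariety {a b : V} (p : Quiver.Path a b) : Set (DetourVar p → K) :=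
  {k | ∃ U : ModuleCat.{max u v w} (PathAlgebra K V ⧸ I), IsMastOf I p U ∧
    ∃ x : U, IsTopElement I x ∧ ∀ d : Detour p,
      pathClass I (d.1.stem.cons d.1.arrow) • x =
        ∑ i : DetourIndex d,
          algebraMap K (PathAlgebra K V ⧸ I) (k ⟨d, i⟩) • pathClass I i.1 • x}

/-- The coordinate ring `A_p` of the variety `V_p`. -/
abbrev CoordRing {a b : V} (p : Quiver.Path a b) : Type (max u v w) :=
  MvPolynomial (DetourVar p) K ⧸ MvPolynomial.vanishingIdeal K (uniserialVariety I p)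

/-- The image in `A_p` of the variable `X_i(α, u)`. -/
noncomputable def coordVar {a b : V} (p : Quiver.Path a b) (d : Detour p) (i : DetourIndex d) :
    CoordRing I p :=
  Ideal.Quotient.mk _ (MvPolynomial.X ⟨d, i⟩)

/-- A detour is a halyard on `p` if at least one of its variables has nonzero image in `A_p`. -/
def IsHalyard {a b : V} (p : Quiver.Path a b) (d : Detour p) : Prop :=
  ∃ i : DetourIndex d, coordVar I p d i ≠ 0

/-- A halyard is slack if the image in `A_p` of at least one of its variables is transcendental
over `K`. -/
def IsSlackHalyard {a b : V} (p : Quiver.Path a b) (d : Detour p) : Prop :=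
  IsHalyard I p d ∧ ∃ i : DetourIndex d, Transcendental K (coordVar I p d i)

/-- The halyards which are not slack are called tight. -/
def IsTightHalyard {a b : V} (p : Quiver.Path a b) (d : Detour p) : Prop :=
  IsHalyard I p d ∧ ¬ IsSlackHalyard I p d

/-- The path `p` has length `l` and passes through the vertices corresponding to the simple modules
`S 0, …, S l`, in this order. A vertex `e` corresponds to the simple module `T` (i.e.
`T ≅ Λ e / J e`) if and only if `e T ≠ 0`. -/
def PassesThrough {l : ℕ} (S : Fin (l + 1) → ModuleCat.{max u v w} (PathAlgebra K V ⧸ I))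
    {a b : V} (p : Quiver.Path a b) : Prop :=
  p.length = l ∧ ∃ e : Fin (l + 1) → V, p.vertices = List.ofFn e ∧
    ∀ i, ∃ x : S i, pathClass I (Quiver.Path.nil : Quiver.Path (e i) (e i)) • x ≠ 0

/-- The path `p` is of the form `γ ^ μ` followed by a path
`e → e₁ → ⋯ → e_ν` (with first arrow `α` if `ν ≥ 1`), where `γ` is a loop at `e`, `μ + ν = length p`,
`e ∉ {e₁, …, e_ν}`, and `e₁ ∉ {e₂, …, e_ν}` if `μ ≥ 1` and `ν ≥ 2`; moreover, every slack halyard on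
`p` is one of the pairs `(α, γ ^ i)` with `0 ≤ i ≤ μ - 1`. (If `ν = 0`, there is no `α` and hence no
slack halyard.) -/
def HasLoopForm {e b : V} (p : Quiver.Path e b) : Prop :=
  ∃ (γ : e ⟶ e) (μ ν : ℕ), μ + ν = p.length ∧
    ((ν = 0 ∧ (⟨e, b, p⟩ : QuiverPath V) = ⟨e, e, loopPow γ μ⟩ ∧
        ∀ d : Detour p, ¬ IsSlackHalyard I p d) ∨
      ∃ (e₁ : V) (α : e ⟶ e₁) (r : Quiver.Path e₁ b), r.length + 1 = ν ∧
        p = (loopPow γ μ).comp (α.toPath.comp r) ∧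
        e ∉ r.vertices ∧
        (1 ≤ μ → 2 ≤ ν → e₁ ∉ r.vertices.tail) ∧
        ∀ d : Detour p, IsSlackHalyard I p d → ∃ i : ℕ, i < μ ∧ d.1 = ⟨α, loopPow γ i⟩)

end Varieties

/-! ### Initial segments of paths -/

section InitialSegments

variable {V : Type v} [Quiver.{w} V]

/-! Let `U` be uniserial with mast `p` and let `x` be a top element. The elements `v x`, with `v`
running through the right subpaths of `p` (the rungs), form a `K`-basis of `U`, and each generates a
term of the unique composition series. An arrow applied to a rung either continues `p`, or belongs
to a detour and is described by coordinates `k`, or gives zero. So `k` determines `U`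
(`nonempty_linearEquiv_of_realizes`), and `k` depends on `U` only through the choice of `x`.

Under (N) the modules with composition series `S` are exactly those with mast `p`
(`isUniserialWithFactors_iff`). The self-extension of `S 0` provides a loop `γ` at the initial
vertex `e`. Segments of masts are masts, so (N) applies to every segment of `p`: the occurrences of
`e` on `p` form one initial run `γ ^ μ`, and a detour with stem shorter than `μ` must end in the
vertex following this run. Call such detours short and the others long.

Any other top element is `c x + w` with `c ≠ 0` and `w` a combination of `γ x, …, γ ^ μ x`. Then `γ
^ μ w = 0`, since it sits at `e` but lies beyond the last occurrence of `e`. So the rungs from `μ`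
on are only rescaled, and the long coordinates are invariants of `U` (`Realizes.eq_of_le_length`).
Conversely, a suitable `w` makes all short coordinates vanish (`ConditionN.exists_normalized`).
Isomorphism types therefore correspond to the points of `V_p` projected to the long coordinates.

A coordinate is transcendental exactly when it takes infinitely many values on `V_p`. So there are
finitely many types if and only if every slack halyard is short, which is the content of the loop
form, its shape being forced by (N). If moreover no halyard is tight, all long coordinates vanish
and one type remains. -/

/-- The right subpath of length `min i (length p)` of a path `p`, with its terminal vertex. -/
def initPath {a : V} : ∀ {b : V}, Quiver.Path a b → ℕ → Σ c : V, Quiver.Path a c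
  | _, .nil, _ => ⟨a, .nil⟩
  | _, .cons q α, i => if i ≤ q.length then initPath q i else ⟨_, q.cons α⟩

/-- The `i`-th vertex of a path. -/
def vtx {a b : V} (p : Quiver.Path a b) (i : ℕ) : V := (initPath p i).1

/-- The right subpath of length `i`, as a path ending in the `i`-th vertex. -/
def seg {a b : V} (p : Quiver.Path a b) (i : ℕ) : Quiver.Path a (vtx p i) := (initPath p i).2

theorem initPath_eq {a b : V} (p : Quiver.Path a b) (i : ℕ) :
    initPath p i = ⟨vtx p i, seg p i⟩ := rfl

theorem initPath_of_le {a b : V} (p : Quiver.Path a b) {i : ℕ} (h : p.length ≤ i) :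
    initPath p i = ⟨b, p⟩ := by
  cases p with
  | nil => rfl
  | cons q α =>
    rw [Quiver.Path.length_cons] at h
    rw [initPath, if_neg (by omega)]

theorem initPath_comp_of_le {a b c : V} (p : Quiver.Path a b) (q : Quiver.Path b c) {i : ℕ}
    (h : i ≤ p.length) : initPath (p.comp q) i = initPath p i := by
  induction q with
  | nil => rfl
  | cons q α ih =>
    rw [Quiver.Path.comp_cons, initPath, if_pos (by rw [Quiver.Path.length_comp]; omega), ih]

theorem initPath_comp_length {a b c : V} (p : Quiver.Path a b) (q : Quiver.Path b c) :
    initPath (p.comp q) p.length = ⟨b, p⟩ := by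
  rw [initPath_comp_of_le p q le_rfl, initPath_of_le p le_rfl]

theorem initPath_comp_add {a b c : V} (p : Quiver.Path a b) (q : Quiver.Path b c) (i : ℕ) :
    initPath (p.comp q) (p.length + i) = ⟨vtx q i, p.comp (seg q i)⟩ := by
  induction q with
  | nil => rw [Quiver.Path.comp_nil, initPath_of_le p (by omega)]; rfl
  | cons q α ih =>
    rw [Quiver.Path.comp_cons, initPath, Quiver.Path.length_comp]
    by_cases h : i ≤ q.length
    · rw [if_pos (by omega), ih]
      have : initPath (q.cons α) i = initPath q i := by rw [initPath, if_pos h]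
      simp only [vtx, seg]
      rw [this]
    · rw [if_neg (by omega)]
      have : initPath (q.cons α) i = ⟨_, q.cons α⟩ := by rw [initPath, if_neg h]
      simp only [vtx, seg]
      rw [this]
      rfl

theorem exists_comp_seg {a b : V} (p : Quiver.Path a b) (i : ℕ) :
    ∃ q, p = (seg p i).comp q := by
  induction p with
  | nil => exact ⟨.nil, rfl⟩
  | cons q α ih =>
    by_cases h : i ≤ q.length
    · have e : initPath (q.cons α) i = initPath q i := by rw [initPath, if_pos h]
      obtain ⟨r, hr⟩ := ih
      simp only [seg, vtx] at hr ⊢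
      rw [e]
      exact ⟨r.cons α, congrArg (fun t => Quiver.Path.cons t α) hr⟩
    · have e : initPath (q.cons α) i = ⟨_, q.cons α⟩ := by rw [initPath, if_neg h]
      simp only [seg, vtx]
      rw [e]
      exact ⟨.nil, rfl⟩

theorem length_seg {a b : V} (p : Quiver.Path a b) {i : ℕ} (h : i ≤ p.length) :
    (seg p i).length = i := by
  induction p with
  | nil => simp only [Quiver.Path.length_nil, Nat.le_zero] at h; subst h; rfl
  | cons q α ih =>
    by_cases h' : i ≤ q.length
    · have e : initPath (q.cons α) i = initPath q i := by rw [initPath, if_pos h']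
      simp only [seg, vtx] at ih ⊢
      rw [e, ih h']
    · have e : initPath (q.cons α) i = ⟨_, q.cons α⟩ := by rw [initPath, if_neg h']
      simp only [seg, vtx]
      rw [e]
      rw [Quiver.Path.length_cons] at h ⊢
      omega

theorem initPath_zero {a b : V} (p : Quiver.Path a b) : initPath p 0 = ⟨a, .nil⟩ := by
  induction p with
  | nil => rfl
  | cons q α ih => rw [initPath, if_pos (Nat.zero_le _), ih]

theorem vtx_zero {a b : V} (p : Quiver.Path a b) : vtx p 0 = a := by rw [vtx, initPath_zero]

theorem vtx_length {a b : V} (p : Quiver.Path a b) : vtx p p.length = b := by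
  rw [vtx, initPath_of_le p le_rfl]

theorem isRightSubpath_seg {a b : V} (p : Quiver.Path a b) (i : ℕ) :
    IsRightSubpath (seg p i) p := exists_comp_seg p i

theorem IsRightSubpath.length_le {a b c : V} {u : Quiver.Path a c} {p : Quiver.Path a b}
    (h : IsRightSubpath u p) : u.length ≤ p.length := by
  obtain ⟨q, rfl⟩ := h
  rw [Quiver.Path.length_comp]
  omega

theorem IsRightSubpath.initPath_eq {a b c : V} {u : Quiver.Path a c} {p : Quiver.Path a b}
    (h : IsRightSubpath u p) : initPath p u.length = ⟨c, u⟩ := by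
  obtain ⟨q, rfl⟩ := h
  exact initPath_comp_length u q

theorem IsRightSubpath.vtx_eq {a b c : V} {u : Quiver.Path a c} {p : Quiver.Path a b}
    (h : IsRightSubpath u p) : vtx p u.length = c := by
  rw [vtx, h.initPath_eq]

theorem exists_seg_succ {a b : V} (p : Quiver.Path a b) {i : ℕ} (h : i < p.length) :
    ∃ β : vtx p i ⟶ vtx p (i + 1), seg p (i + 1) = (seg p i).cons β := by
  obtain ⟨q, hq⟩ := exists_comp_seg p i
  have hl := congrArg Quiver.Path.length hq
  rw [Quiver.Path.length_comp, length_seg p h.le] at hl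
  obtain ⟨c, β, r, -, hr⟩ := q.eq_toPath_comp_of_length_eq_succ (n := q.length - 1) (by omega)
  have e : p = ((seg p i).cons β).comp r := by
    rw [hr, ← Quiver.Path.comp_assoc, Quiver.Path.comp_toPath_eq_cons] at hq
    exact hq
  have e' : initPath p (i + 1) = ⟨c, (seg p i).cons β⟩ := by
    have := initPath_comp_length ((seg p i).cons β) r
    rwa [← e, Quiver.Path.length_cons, length_seg p h.le] at this
  simp only [seg, vtx] at e' ⊢
  rw [e']
  exact ⟨β, rfl⟩

/-- The part of `p` between its vertices number `i` and `j`. -/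
theorem exists_seg_eq_comp {a b : V} (p : Quiver.Path a b) {i j : ℕ} (hij : i ≤ j)
    (hj : j ≤ p.length) :
    ∃ q : Quiver.Path (vtx p i) (vtx p j), q.length = j - i ∧ seg p j = (seg p i).comp q := by
  obtain ⟨n, rfl⟩ := Nat.exists_eq_add_of_le hij
  induction n with
  | zero => exact ⟨.nil, by simp, rfl⟩
  | succ n ih =>
    obtain ⟨q, hq, hs⟩ := ih (by omega) (by omega)
    obtain ⟨β, hβ⟩ := exists_seg_succ p (i := i + n) (by omega)
    refine ⟨q.cons β, by rw [Quiver.Path.length_cons, hq]; omega, ?_⟩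
    rw [Quiver.Path.comp_cons, ← hs]
    exact hβ

theorem vertices_eq_ofFn {a b : V} (p : Quiver.Path a b) :
    p.vertices = List.ofFn fun i : Fin (p.length + 1) => vtx p i := by
  induction p with
  | nil => rfl
  | cons q α ih =>
    rw [Quiver.Path.vertices_cons, ih, List.ofFn_succ_last (n := (q.cons α).length),
      List.concat_eq_append]
    congr 2
    · funext i
      change vtx q i = vtx (q.cons α) i
      have := i.2
      rw [vtx, vtx, initPath, if_pos (by omega)]
    · simp only [Fin.val_last, vtx_length]

variable {a b : V} {p : Quiver.Path a b}

theorem Detour.vtx_eq (d : Detour p) : vtx p d.1.stem.length = d.1.mid := d.2.1.vtx_eq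

theorem DetourIndex.length_injective {d : Detour p} :
    Function.Injective fun i : DetourIndex d => i.1.length := by
  rintro ⟨v, ⟨v', hv⟩, _⟩ ⟨z, ⟨z', hz⟩, _⟩ hl
  exact Subtype.ext ((Quiver.Path.comp_inj' hl).1 (hv.symm.trans hz)).1

theorem exists_isRightSubpath_of_vtx_eq {e : V} {j : ℕ} (hj : j ≤ p.length) (he : vtx p j = e) :
    ∃ v : Quiver.Path a e, IsRightSubpath v p ∧ v.length = j := by
  subst he
  exact ⟨_, isRightSubpath_seg p j, length_seg p hj⟩

-- A right subpath is determined by its length, so sums over `I(α, u)` become sums over positions on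
-- `p`, where coefficients with respect to rungs live.
open Classical in
theorem sum_detourIndex {M : Type*} [AddCommMonoid M] (d : Detour p) (f : ℕ → M) :
    ∑ i : DetourIndex d, f i.1.length =
      ∑ j ∈ Finset.Ico (d.1.stem.length + 1) (p.length + 1) with vtx p j = d.1.tgt, f j := by
  refine Finset.sum_bij (fun i _ => i.1.length) (fun i _ => ?_)
    (fun i _ j _ hij => DetourIndex.length_injective hij) (fun j hj => ?_) fun i _ => rfl
  · rw [Finset.mem_filter, Finset.mem_Ico]
    have := i.2.1.length_le
    exact ⟨⟨i.2.2, by omega⟩, i.2.1.vtx_eq⟩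
  · rw [Finset.mem_filter, Finset.mem_Ico] at hj
    obtain ⟨v, hv, hl⟩ := exists_isRightSubpath_of_vtx_eq (p := p) (by omega) hj.2
    exact ⟨⟨v, hv, by omega⟩, Finset.mem_univ _, hl⟩

end InitialSegments

/-! ### The radical of an admissible quotient of a path algebra -/

section Radical

variable {K : Type u} {V : Type v} [Field K] [Quiver.{w} V]

theorem PathAlgebra.of_mul_of_mem_arrowPower (q p : QuiverPath V) {n : ℕ}
    (h : n ≤ q.path.length + p.path.length) :
    PathAlgebra.of K q * PathAlgebra.of K p ∈ arrowPower K V n := by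
  obtain ⟨b, c, q⟩ := q
  obtain ⟨a, b', p⟩ := p
  by_cases hb : b' = b
  · subst hb
    rw [PathAlgebra.of_mul_of_comp]
    refine Submodule.subset_span ⟨_, ?_, rfl⟩
    rw [Quiver.Path.length_comp]
    change n ≤ q.length + p.length at h
    omega
  · rw [PathAlgebra.of_mul_of_ne hb]
    exact zero_mem _

theorem mem_arrowPower_zero (x : PathAlgebra K V) : x ∈ arrowPower K V 0 := by
  induction x using PathAlgebra.induction_linear with
  | zero => exact zero_mem _
  | add f g hf hg => exact add_mem hf hg
  | smul_of t p => exact Submodule.smul_mem _ _ (Submodule.subset_span ⟨p, Nat.zero_le _, rfl⟩)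

variable [Fintype V]

theorem mul_mem_arrowPower {m n : ℕ} {x y : PathAlgebra K V} (hx : x ∈ arrowPower K V m)
    (hy : y ∈ arrowPower K V n) : x * y ∈ arrowPower K V (m + n) := by
  induction hx using Submodule.span_induction with
  | zero => rw [zero_mul]; exact zero_mem _
  | add x x' _ _ h h' => rw [add_mul]; exact add_mem h h'
  | smul c x _ h => rw [smul_mul_assoc]; exact Submodule.smul_mem _ _ h
  | mem x hx =>
    obtain ⟨q, hq, rfl⟩ := hx
    induction hy using Submodule.span_induction with
    | zero => rw [mul_zero]; exact zero_mem _
    | add x x' _ _ h h' => rw [mul_add]; exact add_mem h h'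
    | smul c x _ h => rw [mul_smul_comm]; exact Submodule.smul_mem _ _ h
    | mem y hy =>
      obtain ⟨p, hp, rfl⟩ := hy
      exact PathAlgebra.of_mul_of_mem_arrowPower q p (by omega)

theorem pow_mem_arrowPower {x : PathAlgebra K V} (hx : x ∈ arrowPower K V 1) (n : ℕ) :
    x ^ n ∈ arrowPower K V n := by
  induction n with
  | zero => exact mem_arrowPower_zero _
  | succ n ih => rw [pow_succ]; exact mul_mem_arrowPower ih hx

variable (I : Ideal (PathAlgebra K V)) [I.IsTwoSided]

theorem pathClass_comp {a b c : V} (p : Quiver.Path a b) (q : Quiver.Path b c) :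
    pathClass I (p.comp q) = pathClass I q * pathClass I p := by
  rw [pathClass, pathClass, pathClass, ← map_mul, PathAlgebra.of_mul_of_comp]

theorem pathClass_cons {a b c : V} (p : Quiver.Path a b) (α : b ⟶ c) :
    pathClass I (p.cons α) = pathClass I α.toPath * pathClass I p := by
  rw [← pathClass_comp, Quiver.Path.comp_toPath_eq_cons]

/-- The residue class of the path of length zero at a vertex. -/
noncomputable abbrev vertexClass (e : V) : PathAlgebra K V ⧸ I :=
  pathClass I (Quiver.Path.nil : Quiver.Path e e)

theorem vertexClass_mul_pathClass {a b : V} (p : Quiver.Path a b) :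
    vertexClass I b * pathClass I p = pathClass I p := by
  rw [← pathClass_comp, Quiver.Path.comp_nil]

theorem pathClass_mul_vertexClass {a b : V} (p : Quiver.Path a b) :
    pathClass I p * vertexClass I a = pathClass I p := by
  rw [← pathClass_comp, Quiver.Path.nil_comp]

theorem pathClass_mul_pathClass_of_ne {a b c d : V} (p : Quiver.Path a b) (q : Quiver.Path c d)
    (h : b ≠ c) : pathClass I q * pathClass I p = 0 := by
  rw [pathClass, pathClass, ← map_mul, PathAlgebra.of_mul_of_ne h, map_zero]

/-- The image in `KΓ / I` of the ideal generated by the arrows. -/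
noncomputable def arrowRadical : Submodule K (PathAlgebra K V ⧸ I) :=
  (arrowPower K V 1).map (Ideal.Quotient.mkₐ K I).toLinearMap

variable {I}

theorem mem_arrowRadical {r : PathAlgebra K V ⧸ I} :
    r ∈ arrowRadical I ↔ ∃ x ∈ arrowPower K V 1, Ideal.Quotient.mk I x = r := Iff.rfl

theorem pathClass_mem_arrowRadical {a b : V} {p : Quiver.Path a b} (h : 1 ≤ p.length) :
    pathClass I p ∈ arrowRadical I :=
  mem_arrowRadical.2 ⟨_, Submodule.subset_span ⟨⟨a, b, p⟩, h, rfl⟩, rfl⟩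

theorem mul_mem_arrowRadical (a : PathAlgebra K V ⧸ I) {r : PathAlgebra K V ⧸ I}
    (h : r ∈ arrowRadical I) : a * r ∈ arrowRadical I := by
  obtain ⟨x, hx, rfl⟩ := mem_arrowRadical.1 h
  obtain ⟨y, rfl⟩ := Ideal.Quotient.mk_surjective a
  have hxy := mul_mem_arrowPower (mem_arrowPower_zero y) hx
  rw [zero_add] at hxy
  exact mem_arrowRadical.2 ⟨y * x, hxy, map_mul _ _ _⟩

theorem arrowRadical_induction {P : PathAlgebra K V ⧸ I → Prop} (zero : P 0)
    (add : ∀ x y, P x → P y → P (x + y)) (smul : ∀ (c : K) x, P x → P (c • x))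
    (path : ∀ {a b : V} (p : Quiver.Path a b), 1 ≤ p.length → P (pathClass I p))
    {r : PathAlgebra K V ⧸ I} (h : r ∈ arrowRadical I) : P r := by
  obtain ⟨x, hx, rfl⟩ := mem_arrowRadical.1 h
  clear h
  induction hx using Submodule.span_induction with
  | zero => rwa [map_zero]
  | add x y hx hy h h' =>
    rw [map_add]
    exact add _ _ h h'
  | smul c x hx h => exact smul c _ h
  | mem x hx =>
    obtain ⟨⟨a, b, p⟩, hp, rfl⟩ := hx
    exact path p hp

theorem quotient_induction {P : PathAlgebra K V ⧸ I → Prop} (zero : P 0)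
    (add : ∀ x y, P x → P y → P (x + y)) (smul : ∀ (c : K) x, P x → P (c • x))
    (path : ∀ {a b : V} (p : Quiver.Path a b), P (pathClass I p))
    (r : PathAlgebra K V ⧸ I) : P r := by
  obtain ⟨x, rfl⟩ := Ideal.Quotient.mk_surjective r
  induction x using PathAlgebra.induction_linear with
  | zero => rwa [map_zero]
  | add f g hf hg => rw [map_add]; exact add _ _ hf hg
  | smul_of t p => exact smul t _ (path p.path)

theorem mul_mem_arrowRadical_right {r : PathAlgebra K V ⧸ I}
    (h : r ∈ arrowRadical I) (a : PathAlgebra K V ⧸ I) : r * a ∈ arrowRadical I := by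
  obtain ⟨x, hx, rfl⟩ := mem_arrowRadical.1 h
  obtain ⟨y, rfl⟩ := Ideal.Quotient.mk_surjective a
  have hxy := mul_mem_arrowPower hx (mem_arrowPower_zero y)
  rw [add_zero] at hxy
  exact mem_arrowRadical.2 ⟨x * y, hxy, map_mul _ _ _⟩

theorem exists_forall_pow_eq_zero (hI : IsAdmissible I) :
    ∃ N : ℕ, ∀ r ∈ arrowRadical I, r ^ N = 0 := by
  obtain ⟨⟨N, -, hN⟩, -⟩ := hI
  refine ⟨N, fun r hr => ?_⟩
  obtain ⟨x, hx, rfl⟩ := mem_arrowRadical.1 hr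
  rw [← map_pow]
  exact Ideal.Quotient.eq_zero_iff_mem.2 (hN _ (pow_mem_arrowPower hx N))

/-- A path starting at `e` is either trivial or of positive length, so `Λ e` is spanned by `e`
together with its radical part. -/
theorem mul_vertexClass_eq (a : PathAlgebra K V ⧸ I) (e : V) :
    ∃ c : K, ∃ r ∈ arrowRadical I,
      a * vertexClass I e = c • vertexClass I e + r * vertexClass I e := by
  refine quotient_induction (P := fun a => ∃ c : K, ∃ r ∈ arrowRadical I,
      a * vertexClass I e = c • vertexClass I e + r * vertexClass I e) ?_ ?_ ?_ ?_ a
  · exact ⟨0, 0, zero_mem _, by rw [zero_mul, zero_smul, zero_add]⟩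
  · intro x y hx hy
    obtain ⟨c, r, hr, hx⟩ := hx
    obtain ⟨d, s, hs, hy⟩ := hy
    refine ⟨c + d, r + s, add_mem hr hs, ?_⟩
    rw [add_mul, hx, hy, add_smul, add_mul]
    abel
  · intro t x hx
    obtain ⟨c, r, hr, hx⟩ := hx
    refine ⟨t * c, t • r, Submodule.smul_mem _ _ hr, ?_⟩
    rw [smul_mul_assoc, hx, smul_add, mul_smul, smul_mul_assoc]
  · intro a b p
    by_cases hp : 1 ≤ p.length
    · exact ⟨0, _, pathClass_mem_arrowRadical hp, by rw [zero_smul, zero_add]⟩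
    · obtain rfl := p.eq_of_length_zero (by omega)
      obtain rfl := p.eq_nil_of_length_zero (by omega)
      by_cases h : e = a
      · subst h
        exact ⟨1, 0, zero_mem _, by rw [pathClass_mul_vertexClass, one_smul, zero_mul, add_zero]⟩
      · exact ⟨0, 0, zero_mem _, by
          rw [pathClass_mul_pathClass_of_ne _ _ _ h, zero_smul, zero_mul, add_zero]⟩

section Modules

variable {U : Type*} [AddCommGroup U] [Module (PathAlgebra K V ⧸ I) U]

/-- Radical elements are nilpotent. This fixed-point form of Nakayama's lemma is how admissibility
enters the module arguments below. -/
theorem eq_zero_of_arrowRadical_smul_eq (hI : IsAdmissible I) {r : PathAlgebra K V ⧸ I}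
    (hr : r ∈ arrowRadical I) {y : U} (h : r • y = y) : y = 0 := by
  obtain ⟨N, hN⟩ := exists_forall_pow_eq_zero hI
  have h' : ∀ n, r ^ n • y = y := fun n => by
    induction n with
    | zero => simp
    | succ n ih => rw [pow_succ, mul_smul, h, ih]
  rw [← h' N, hN r hr, zero_smul]

theorem vertexClass_smul_pathClass_smul {a b : V} (p : Quiver.Path a b) (x : U) :
    vertexClass I b • pathClass I p • x = pathClass I p • x := by
  rw [← mul_smul, vertexClass_mul_pathClass]

theorem pathClass_smul_eq_zero_of_ne {a b c : V} (p : Quiver.Path a b) {y : U}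
    (hy : vertexClass I c • y = y) (h : a ≠ c) : pathClass I p • y = 0 := by
  rw [← hy, ← mul_smul, pathClass_mul_pathClass_of_ne _ _ _ (Ne.symm h), zero_smul]

/-- To check that the radical maps an element into a submodule, it suffices to look at arrows. -/
theorem arrowRadical_smul_mem {e : V} {y : U} (hy : vertexClass I e • y = y)
    {N : Submodule (PathAlgebra K V ⧸ I) U}
    (h : ∀ (e' : V) (β : e ⟶ e'), pathClass I β.toPath • y ∈ N) {r : PathAlgebra K V ⧸ I}
    (hr : r ∈ arrowRadical I) : r • y ∈ N := by
  refine arrowRadical_induction (P := fun r => r • y ∈ N) ?_ ?_ ?_ ?_ hr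
  · rw [zero_smul]
    exact zero_mem _
  · intro x z hx hz
    rw [add_smul]
    exact add_mem hx hz
  · intro c x hx
    rw [Algebra.smul_def, mul_smul]
    exact N.smul_mem _ hx
  · intro a b p hp
    by_cases ha : a = e
    · subst ha
      obtain ⟨c, β, q, -, rfl⟩ := p.eq_toPath_comp_of_length_eq_succ (n := p.length - 1) (by omega)
      rw [pathClass_comp, mul_smul]
      exact N.smul_mem _ (h _ β)
    · rw [pathClass_smul_eq_zero_of_ne p hy ha]
      exact zero_mem _

theorem exists_smul_eq_of_vertexClass_smul {e : V} {y : U} (hy : vertexClass I e • y = y)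
    (a : PathAlgebra K V ⧸ I) :
    ∃ c : K, ∃ r ∈ arrowRadical I, a • y = algebraMap K (PathAlgebra K V ⧸ I) c • y + r • y := by
  obtain ⟨c, r, hr, h⟩ := mul_vertexClass_eq a e
  refine ⟨c, r, hr, ?_⟩
  rw [← hy, ← mul_smul, h, add_smul, mul_smul, Algebra.smul_def, mul_smul]

end Modules

/-! ### Simple modules -/

section Simple

variable {T : Type*} [AddCommGroup T] [Module (PathAlgebra K V ⧸ I) T]
  {T' : Type*} [AddCommGroup T'] [Module (PathAlgebra K V ⧸ I) T']

/-- If `r t ≠ 0`, then `r t` generates `T`, so `t = (a r) t` for some `a`, with `a r` again in the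
radical. -/
theorem arrowRadical_smul_eq_zero (hI : IsAdmissible I) [IsSimpleModule (PathAlgebra K V ⧸ I) T]
    {r : PathAlgebra K V ⧸ I} (hr : r ∈ arrowRadical I) (t : T) : r • t = 0 := by
  by_contra h
  have hs := IsSimpleModule.span_singleton_eq_top (PathAlgebra K V ⧸ I) h
  have ht : t ∈ Submodule.span (PathAlgebra K V ⧸ I) {r • t} := hs ▸ Submodule.mem_top
  obtain ⟨a, ha⟩ := Submodule.mem_span_singleton.1 ht
  rw [← mul_smul] at ha
  rw [eq_zero_of_arrowRadical_smul_eq hI (mul_mem_arrowRadical a hr) ha, smul_zero] at h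
  exact h rfl

theorem eq_of_vertexClass_smul_ne_zero (hI : IsAdmissible I)
    [IsSimpleModule (PathAlgebra K V ⧸ I) T] {e e' : V} {t t' : T}
    (h : vertexClass I e • t ≠ 0) (h' : vertexClass I e' • t' ≠ 0) : e = e' := by
  by_contra hne
  have hs := IsSimpleModule.span_singleton_eq_top (PathAlgebra K V ⧸ I) h
  have ht : t' ∈ Submodule.span (PathAlgebra K V ⧸ I) {vertexClass I e • t} :=
    hs ▸ Submodule.mem_top
  obtain ⟨a, ha⟩ := Submodule.mem_span_singleton.1 ht
  have hy := vertexClass_smul_pathClass_smul (I := I) (Quiver.Path.nil : Quiver.Path e e) t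
  obtain ⟨c, r, hr, hc⟩ := exists_smul_eq_of_vertexClass_smul hy a
  rw [ha, arrowRadical_smul_eq_zero hI hr, add_zero] at hc
  apply h'
  rw [hc, ← mul_smul, ← Algebra.commutes, mul_smul,
    pathClass_smul_eq_zero_of_ne _ hy (Ne.symm hne), smul_zero]

end Simple

/-- Cyclic modules whose generators have the same annihilator are isomorphic. -/
theorem nonempty_linearEquiv_of_forall_smul_eq_zero_iff {R M N : Type*} [Ring R] [AddCommGroup M]
    [Module R M] [AddCommGroup N] [Module R N] {x : M} {y : N}
    (hx : Submodule.span R {x} = ⊤) (hy : Submodule.span R {y} = ⊤)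
    (h : ∀ a : R, a • x = 0 ↔ a • y = 0) : Nonempty (M ≃ₗ[R] N) := by
  have hk : LinearMap.ker (LinearMap.toSpanSingleton R M x) =
      LinearMap.ker (LinearMap.toSpanSingleton R N y) := by
    ext a
    simpa using h a
  have hx' : Function.Surjective (LinearMap.toSpanSingleton R M x) := by
    rw [← LinearMap.range_eq_top, LinearMap.range_toSpanSingleton, hx]
  have hy' : Function.Surjective (LinearMap.toSpanSingleton R N y) := by
    rw [← LinearMap.range_eq_top, LinearMap.range_toSpanSingleton, hy]
  exact ⟨(LinearMap.quotKerEquivOfSurjective _ hx').symm.trans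
    ((Submodule.quotEquivOfEq _ _ hk).trans (LinearMap.quotKerEquivOfSurjective _ hy'))⟩

/-- The scalar `c` depends on `a` and `e` but not on the module; hence generators at the same vertex
that are killed by the radical have equal annihilators. -/
theorem smul_eq_zero_iff_coeff_eq_zero {M : Type*} [AddCommGroup M]
    [Module (PathAlgebra K V ⧸ I) M] {e : V} {a r : PathAlgebra K V ⧸ I} {c : K}
    (h : a * vertexClass I e = c • vertexClass I e + r * vertexClass I e) {z : M}
    (hz : vertexClass I e • z = z) (hz0 : z ≠ 0) (hzr : r • z = 0) : a • z = 0 ↔ c = 0 := by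
  have : a • z = algebraMap K (PathAlgebra K V ⧸ I) c • z := by
    calc a • z = (a * vertexClass I e) • z := by rw [mul_smul, hz]
      _ = _ := by
        rw [h, add_smul, mul_smul, hz, hzr, add_zero, Algebra.smul_def, mul_smul, hz]
  rw [this]
  refine ⟨fun h0 => ?_, fun h0 => by rw [h0, map_zero, zero_smul]⟩
  by_contra hc
  apply hz0
  rw [← one_smul (PathAlgebra K V ⧸ I) z, ← map_one (algebraMap K (PathAlgebra K V ⧸ I)),
    ← inv_mul_cancel₀ hc, map_mul, mul_smul, h0, smul_zero]

theorem smul_eq_zero_iff_of_arrowRadical {M N : Type*} [AddCommGroup M]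
    [Module (PathAlgebra K V ⧸ I) M] [AddCommGroup N] [Module (PathAlgebra K V ⧸ I) N]
    {e : V} {x : M} {y : N} (hx : vertexClass I e • x = x) (hy : vertexClass I e • y = y)
    (hx0 : x ≠ 0) (hy0 : y ≠ 0) (hxr : ∀ r ∈ arrowRadical I, r • x = 0)
    (hyr : ∀ r ∈ arrowRadical I, r • y = 0) (a : PathAlgebra K V ⧸ I) :
    a • x = 0 ↔ a • y = 0 := by
  obtain ⟨c, r, hr, h⟩ := mul_vertexClass_eq a e
  rw [smul_eq_zero_iff_coeff_eq_zero h hx hx0 (hxr r hr),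
    smul_eq_zero_iff_coeff_eq_zero h hy hy0 (hyr r hr)]

end Radical

/-! ### Lengths -/

section Length

variable {R M : Type*} [Ring R] [AddCommGroup M] [Module R M]

theorem length_eq_length_add_length_quotient {A B : Submodule R M} (h : A ≤ B) :
    Module.length R B = Module.length R A + Module.length R (B ⧸ A.submoduleOf B) := by
  refine Module.length_eq_add_of_exact (Submodule.inclusion h) (A.submoduleOf B).mkQ
    (Submodule.inclusion_injective h) (Submodule.mkQ_surjective _) ?_
  rw [LinearMap.exact_iff, Submodule.ker_mkQ, Submodule.range_inclusion]
  rfl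

theorem length_eq_length_add_one_of_covBy {A B : Submodule R M} (h : A ⋖ B) :
    Module.length R B = Module.length R A + 1 := by
  have : IsSimpleModule R (B ⧸ A.submoduleOf B) := (covBy_iff_quot_is_simple h.le).1 h
  rw [length_eq_length_add_length_quotient h.le,
    Module.length_eq_one R (B ⧸ A.submoduleOf B)]

theorem length_add_one_le_of_lt {A B : Submodule R M} (h : A < B) :
    Module.length R A + 1 ≤ Module.length R B := by
  rw [length_eq_length_add_length_quotient h.le]
  gcongr
  have : Nontrivial (B ⧸ A.submoduleOf B) := by
    rw [Submodule.Quotient.nontrivial_iff]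
    intro h'
    apply h.not_ge
    intro z hz
    have : (⟨z, hz⟩ : B) ∈ A.submoduleOf B := h' ▸ Submodule.mem_top
    exact this
  exact Order.one_le_iff_ne_zero.2 (Module.length_pos (R := R)).ne'

end Length

/-! ### The chain of submodules attached to a path -/

section Ladders

variable {K : Type u} {V : Type v} [Field K] [Quiver.{w} V] [Fintype V]
  (I : Ideal (PathAlgebra K V)) [I.IsTwoSided] {a b : V} (p : Quiver.Path a b)
  {U : Type*} [AddCommGroup U] [Module (PathAlgebra K V ⧸ I) U] (x : U)

/-- The product of the right subpath of length `i` of `p` with `x`. -/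
noncomputable def rung (i : ℕ) : U := if i ≤ p.length then pathClass I (seg p i) • x else 0

/-- The submodule generated by the `i`-th rung. -/
noncomputable def rungSpan (i : ℕ) : Submodule (PathAlgebra K V ⧸ I) U :=
  Submodule.span _ {rung I p x i}

/-- The element `x` generates the module, has nonzero image under `p`, and each arrow maps each rung
into the submodule generated by the next one. -/
structure IsLadder : Prop where
  vertex : vertexClass I a • x = x
  ne_zero : pathClass I p • x ≠ 0
  span_eq_top : Submodule.span (PathAlgebra K V ⧸ I) {x} = ⊤
  step : ∀ i ≤ p.length, ∀ r ∈ arrowRadical I, r • rung I p x i ∈ rungSpan I p x (i + 1)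

variable {I p x}

theorem rung_of_le {i : ℕ} (h : i ≤ p.length) : rung I p x i = pathClass I (seg p i) • x :=
  if_pos h

theorem rung_of_lt {i : ℕ} (h : p.length < i) : rung I p x i = 0 := if_neg (by omega)

theorem IsRightSubpath.smul_eq_rung {c : V} {u : Quiver.Path a c} (h : IsRightSubpath u p) :
    pathClass I u • x = rung I p x u.length := by
  rw [rung_of_le h.length_le]
  -- The end of `seg p u.length` equals `c` only propositionally; quantifying over the pair (vertex,
  -- path) avoids a cast.
  have key : ∀ s : Σ c : V, Quiver.Path a c, s = ⟨c, u⟩ →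
      pathClass I u • x = pathClass I s.2 • x := by
    rintro s rfl
    rfl
  exact key _ h.initPath_eq

theorem rung_length : rung I p x p.length = pathClass I p • x :=
  (IsRightSubpath.smul_eq_rung ⟨.nil, rfl⟩).symm

theorem rung_zero (hx : vertexClass I a • x = x) : rung I p x 0 = x := by
  have := IsRightSubpath.smul_eq_rung (I := I) (x := x) (p := p) (u := .nil) ⟨p, by simp⟩
  rw [Quiver.Path.length_nil] at this
  rw [← this, hx]

theorem vertexClass_smul_rung (i : ℕ) :
    vertexClass I (vtx p i) • rung I p x i = rung I p x i := by
  by_cases h : i ≤ p.length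
  · rw [rung_of_le h, vertexClass_smul_pathClass_smul]
  · rw [rung_of_lt (by omega), smul_zero]

theorem rung_succ {i : ℕ} (β : vtx p i ⟶ vtx p (i + 1)) (hβ : seg p (i + 1) = (seg p i).cons β)
    (h : i < p.length) : rung I p x (i + 1) = pathClass I β.toPath • rung I p x i := by
  rw [rung_of_le (i := i + 1) h, rung_of_le h.le, hβ, pathClass_cons, mul_smul]

theorem exists_rung_succ (i : ℕ) : ∃ r ∈ arrowRadical I, rung I p x (i + 1) = r • rung I p x i := by
  by_cases h : i < p.length
  · obtain ⟨β, hβ⟩ := exists_seg_succ p h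
    exact ⟨_, pathClass_mem_arrowRadical le_rfl, rung_succ β hβ h⟩
  · exact ⟨0, zero_mem _, by rw [rung_of_lt (by omega), zero_smul]⟩

theorem rung_ne_zero (hx : pathClass I p • x ≠ 0) {i : ℕ} (h : i ≤ p.length) :
    rung I p x i ≠ 0 := by
  obtain ⟨q, hq⟩ := exists_comp_seg p i
  intro h0
  rw [rung_of_le h] at h0
  apply hx
  rw [hq, pathClass_comp, mul_smul, h0, smul_zero]

theorem rung_mem (i : ℕ) : rung I p x i ∈ rungSpan I p x i := Submodule.mem_span_singleton_self _

theorem mem_rungSpan {i : ℕ} {z : U} : z ∈ rungSpan I p x i ↔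
    ∃ r : PathAlgebra K V ⧸ I, r • rung I p x i = z :=
  Submodule.mem_span_singleton

theorem rungSpan_le_iff {i : ℕ} {N : Submodule (PathAlgebra K V ⧸ I) U} :
    rungSpan I p x i ≤ N ↔ rung I p x i ∈ N := by
  rw [rungSpan, Submodule.span_singleton_le_iff_mem]

theorem rungSpan_antitone : Antitone (rungSpan I p x) := by
  refine antitone_nat_of_succ_le fun i => rungSpan_le_iff.2 ?_
  obtain ⟨r, -, hr⟩ := exists_rung_succ (I := I) (p := p) (x := x) i
  rw [hr]
  exact Submodule.smul_mem _ _ (rung_mem i)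

theorem rungSpan_of_lt {i : ℕ} (h : p.length < i) : rungSpan I p x i = ⊥ := by
  rw [rungSpan, rung_of_lt h, Submodule.span_zero_singleton]

/-- The next rung is a radical multiple of this one, so membership would make this rung a fixed
point of a radical element. -/
theorem rung_notMem_rungSpan_succ (hI : IsAdmissible I) (hx : pathClass I p • x ≠ 0) {i : ℕ}
    (h : i ≤ p.length) : rung I p x i ∉ rungSpan I p x (i + 1) := by
  intro hm
  obtain ⟨s, hs⟩ := mem_rungSpan.1 hm
  obtain ⟨r, hr, hr'⟩ := exists_rung_succ (I := I) (p := p) (x := x) i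
  rw [hr', ← mul_smul] at hs
  exact rung_ne_zero hx h (eq_zero_of_arrowRadical_smul_eq hI (mul_mem_arrowRadical s hr) hs)

theorem rungSpan_succ_lt (hI : IsAdmissible I) (hx : pathClass I p • x ≠ 0) {i : ℕ}
    (h : i ≤ p.length) : rungSpan I p x (i + 1) < rungSpan I p x i :=
  lt_of_le_of_ne (rungSpan_antitone i.le_succ) fun he =>
    rung_notMem_rungSpan_succ hI hx h (he ▸ rung_mem i)

theorem length_rungSpan_ge (hI : IsAdmissible I) (hx : pathClass I p • x ≠ 0) {i n : ℕ}
    (h : i + n = p.length + 1) :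
    (n : ℕ∞) ≤ Module.length (PathAlgebra K V ⧸ I) (rungSpan I p x i) := by
  induction n generalizing i with
  | zero => simp
  | succ n ih =>
    refine le_trans ?_ (length_add_one_le_of_lt (rungSpan_succ_lt hI hx (i := i) (by omega)))
    push_cast
    gcongr
    exact ih (by omega)

theorem length_add_le_of_rungSpan_le (hI : IsAdmissible I) (hx : pathClass I p • x ≠ 0) {i : ℕ}
    (h : i ≤ p.length + 1) :
    Module.length (PathAlgebra K V ⧸ I) (rungSpan I p x i) + i ≤
      Module.length (PathAlgebra K V ⧸ I) (rungSpan I p x 0) := by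
  induction i with
  | zero => simp
  | succ n ih =>
    refine le_trans ?_ (ih (by omega))
    push_cast
    rw [add_comm (n : ℕ∞) 1, ← add_assoc]
    gcongr
    exact length_add_one_le_of_lt (rungSpan_succ_lt hI hx (by omega))

/-- In a uniserial module with mast `p`, every normed element not annihilated by `p` gives rise to a
ladder. -/
theorem IsMastOf.isLadder (hI : IsAdmissible I) (hp : IsMastOf I p U)
    (hv : vertexClass I a • x = x) (hx : pathClass I p • x ≠ 0) : IsLadder I p x := by
  obtain ⟨hu, hl, -⟩ := hp
  have h0 := length_rungSpan_ge hI hx (i := 0) (n := p.length + 1) (by omega)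
  -- The strictly descending spans already account for the full length `p.length + 1`, so no further
  -- submodule fits between neighbours.
  have hcov {i : ℕ} (hi : i ≤ p.length) {N : Submodule (PathAlgebra K V ⧸ I) U}
      (h1 : rungSpan I p x (i + 1) < N) (h2 : N ≤ rungSpan I p x i) : N = rungSpan I p x i := by
    by_contra hne
    have h3 := length_add_one_le_of_lt h1
    have h4 := length_add_one_le_of_lt (lt_of_le_of_ne h2 hne)
    have h5 := length_rungSpan_ge hI hx (i := i + 1) (n := p.length - i) (by omega)
    have h6 := length_add_le_of_rungSpan_le hI hx (i := i) (by omega)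
    have h7 := Module.length_le_of_injective (R := PathAlgebra K V ⧸ I)
      (rungSpan I p x 0).subtype (Submodule.subtype_injective _)
    rw [hl] at h7
    have h8 : ((p.length - i : ℕ) : ℕ∞) + 1 + 1 + i ≤ ((p.length + 1 : ℕ) : ℕ∞) :=
      le_trans (le_trans (by gcongr; exact le_trans (by gcongr; exact le_trans (by gcongr) h3) h4)
        h6) h7
    norm_cast at h8
    omega
  refine ⟨hv, hx, ?_, fun i hi r hr => ?_⟩
  · have h1 : rungSpan I p x 0 = ⊤ := by
      by_contra hne
      have := length_add_one_le_of_lt (lt_top_iff_ne_top.2 hne)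
      rw [Module.length_top, hl] at this
      have := le_trans (add_le_add_left h0 1) this
      norm_cast at this
      omega
    rwa [rungSpan, rung_zero hv] at h1
  · rw [← Submodule.span_singleton_le_iff_mem]
    -- By uniseriality, the only bad case is that `r • rung i` generates more than the next span;
    -- then it generates the `i`-th rung itself, contradicting nilpotency.
    rcases hu (Submodule.span _ {r • rung I p x i}) (rungSpan I p x (i + 1)) with h | h
    · exact h
    · by_contra hne
      have h1 := hcov hi (lt_of_le_not_ge h hne) (by
        rw [Submodule.span_singleton_le_iff_mem]
        exact Submodule.smul_mem _ _ (rung_mem i))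
      have h2 : rung I p x i ∈ Submodule.span (PathAlgebra K V ⧸ I) {r • rung I p x i} :=
        h1 ▸ rung_mem i
      obtain ⟨s, hs⟩ := Submodule.mem_span_singleton.1 h2
      rw [← mul_smul] at hs
      exact rung_ne_zero hx hi (eq_zero_of_arrowRadical_smul_eq hI (mul_mem_arrowRadical s hr) hs)

theorem IsMastOf.exists_isLadder (hI : IsAdmissible I) (hp : IsMastOf I p U) :
    ∃ x : U, IsLadder I p x := by
  obtain ⟨x, hx⟩ := hp.2.2
  refine ⟨vertexClass I a • x, hp.isLadder hI ?_ ?_⟩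
  · rw [vertexClass_smul_pathClass_smul]
  · rwa [← mul_smul, pathClass_mul_vertexClass]

namespace IsLadder

variable (h : IsLadder I p x)
include h

theorem rungSpan_zero : rungSpan I p x 0 = ⊤ := by
  rw [rungSpan, rung_zero h.vertex, h.span_eq_top]

theorem smul_mem {i : ℕ} {z : U} (hz : z ∈ rungSpan I p x i) {r : PathAlgebra K V ⧸ I}
    (hr : r ∈ arrowRadical I) : r • z ∈ rungSpan I p x (i + 1) := by
  obtain ⟨s, rfl⟩ := mem_rungSpan.1 hz
  by_cases hi : i ≤ p.length
  · rw [← mul_smul]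
    exact h.step i hi _ (mul_mem_arrowRadical_right hr s)
  · rw [rung_of_lt (by omega), smul_zero, smul_zero]
    exact zero_mem _

theorem seg_smul_mem {i j : ℕ} {z : U} (hz : z ∈ rungSpan I p x i) (hj : j ≤ p.length) :
    pathClass I (seg p j) • z ∈ rungSpan I p x (i + j) := by
  induction j with
  | zero =>
    obtain ⟨s, rfl⟩ := mem_rungSpan.1 hz
    exact Submodule.smul_mem _ _ (Submodule.smul_mem _ _ (rung_mem i))
  | succ j ih =>
    obtain ⟨β, hβ⟩ := exists_seg_succ p (i := j) (by omega)
    rw [hβ, pathClass_cons, mul_smul]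
    exact h.smul_mem (ih (by omega)) (pathClass_mem_arrowRadical le_rfl)

/-- Write `z = c v + r v` with `v` the rung and `r` radical. Since `z` is not in the next span, `c ≠
0`; modulo `z` the rung is then fixed by `-c⁻¹ r`, hence zero. -/
theorem rungSpan_eq_span {i : ℕ} (hI : IsAdmissible I) {z : U} (hz : z ∈ rungSpan I p x i)
    (hz' : z ∉ rungSpan I p x (i + 1)) :
    rungSpan I p x i = Submodule.span (PathAlgebra K V ⧸ I) {z} := by
  refine le_antisymm (rungSpan_le_iff.2 ?_) ((Submodule.span_singleton_le_iff_mem _ _).2 hz)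
  have hi : i ≤ p.length := by
    by_contra hi
    rw [rungSpan_of_lt (by omega)] at hz hz'
    exact hz' hz
  obtain ⟨s, rfl⟩ := mem_rungSpan.1 hz
  obtain ⟨c, r, hr, hc⟩ := exists_smul_eq_of_vertexClass_smul
    (vertexClass_smul_rung (I := I) (p := p) (x := x) i) s
  have hc0 : c ≠ 0 := by
    rintro rfl
    apply hz'
    rw [hc, map_zero, zero_smul, zero_add]
    exact h.step i hi r hr
  rw [← Submodule.Quotient.mk_eq_zero]
  refine eq_zero_of_arrowRadical_smul_eq hI (Submodule.smul_mem _ (-c⁻¹) hr) ?_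
  have h0 : (Submodule.span (PathAlgebra K V ⧸ I) {s • rung I p x i}).mkQ
      (algebraMap K (PathAlgebra K V ⧸ I) c • rung I p x i + r • rung I p x i) = 0 := by
    rw [Submodule.mkQ_apply, Submodule.Quotient.mk_eq_zero, ← hc]
    exact Submodule.mem_span_singleton_self _
  rw [map_add, map_smul, map_smul] at h0
  change (-c⁻¹ • r) • (Submodule.mkQ _) _ = (Submodule.mkQ _) _
  rw [Algebra.smul_def, mul_smul, ← sub_eq_zero, eq_neg_of_add_eq_zero_right h0, map_neg, neg_smul,
    smul_neg, neg_neg, ← mul_smul, ← map_mul, inv_mul_cancel₀ hc0, map_one, one_smul, sub_self]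

/-- Take the first rung span contained in `N`. An element of `N` outside it would lie in an earlier
span but not in the following one, hence generate that earlier span inside `N`. -/
theorem eq_rungSpan (hI : IsAdmissible I) (N : Submodule (PathAlgebra K V ⧸ I) U) :
    ∃ i, N = rungSpan I p x i := by
  classical
  have hex : ∃ i, rungSpan I p x i ≤ N :=
    ⟨p.length + 1, by rw [rungSpan_of_lt (by omega)]; exact bot_le⟩
  refine ⟨Nat.find hex, le_antisymm (fun z hz => ?_) (Nat.find_spec hex)⟩
  by_contra hz'
  have hex' : ∃ j, z ∉ rungSpan I p x j := ⟨_, hz'⟩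
  have hj0 : Nat.find hex' ≠ 0 := fun h0 => by
    have := Nat.find_spec hex'
    rw [h0, h.rungSpan_zero] at this
    exact this Submodule.mem_top
  obtain ⟨j, hj⟩ := Nat.exists_eq_succ_of_ne_zero hj0
  have h1 : z ∈ rungSpan I p x j := not_not.1 (Nat.find_min hex' (m := j) (by omega))
  have h2 : z ∉ rungSpan I p x (j + 1) := by
    have := Nat.find_spec hex'
    rwa [hj] at this
  have h3 : rungSpan I p x j ≤ N := by
    rw [h.rungSpan_eq_span hI h1 h2, Submodule.span_singleton_le_iff_mem]
    exact hz
  exact hz' (rungSpan_antitone (Nat.find_le h3) h1)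

theorem isUniserial (hI : IsAdmissible I) : IsUniserial (PathAlgebra K V ⧸ I) U := by
  intro M N
  obtain ⟨i, rfl⟩ := h.eq_rungSpan hI M
  obtain ⟨j, rfl⟩ := h.eq_rungSpan hI N
  exact (le_total j i).imp (rungSpan_antitone ·) (rungSpan_antitone ·)

theorem rungSpan_covBy (hI : IsAdmissible I) {i : ℕ} (hi : i ≤ p.length) :
    rungSpan I p x (i + 1) ⋖ rungSpan I p x i := by
  refine ⟨rungSpan_succ_lt hI h.ne_zero hi, fun {N} h1 h2 => ?_⟩
  obtain ⟨j, rfl⟩ := h.eq_rungSpan hI N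
  rcases Nat.lt_or_ge i j with hj | hj
  · exact h1.not_ge (rungSpan_antitone hj)
  · exact h2.not_ge (rungSpan_antitone hj)

theorem length_rungSpan (hI : IsAdmissible I) {i n : ℕ} (hi : i + n = p.length + 1) :
    Module.length (PathAlgebra K V ⧸ I) (rungSpan I p x i) = n := by
  induction n generalizing i with
  | zero =>
    rw [rungSpan_of_lt (by omega), Module.length_bot]
    rfl
  | succ n ih =>
    rw [length_eq_length_add_one_of_covBy (h.rungSpan_covBy hI (i := i) (by omega)),
      ih (by omega)]
    rfl

theorem isMastOf (hI : IsAdmissible I) : IsMastOf I p U := by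
  refine ⟨h.isUniserial hI, ?_, x, h.ne_zero⟩
  rw [← Module.length_top, ← h.rungSpan_zero, h.length_rungSpan hI (Nat.zero_add _)]

theorem of_notMem (hI : IsAdmissible I) {x' : U} (hv : vertexClass I a • x' = x')
    (hx' : x' ∉ rungSpan I p x 1) : IsLadder I p x' := by
  refine (h.isMastOf hI).isLadder hI hv fun h0 => h.ne_zero ?_
  have hx : x ∈ Submodule.span (PathAlgebra K V ⧸ I) {x'} := by
    rw [← h.rungSpan_eq_span hI (i := 0) (h.rungSpan_zero ▸ Submodule.mem_top) hx',
      h.rungSpan_zero]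
    exact Submodule.mem_top
  obtain ⟨s, hs⟩ := Submodule.mem_span_singleton.1 hx
  obtain ⟨c, r, hr, hc⟩ := exists_smul_eq_of_vertexClass_smul hv s
  -- Multiplying an element of the span of rung 1 by all of `p` pushes it past the last rung, so
  -- only the scalar part of `s` survives under `p`.
  have h1 : r • x' ∈ rungSpan I p x 1 :=
    h.smul_mem (i := 0) (h.rungSpan_zero ▸ Submodule.mem_top) hr
  have h2 := h.seg_smul_mem h1 le_rfl
  rw [rungSpan_of_lt (by omega), Submodule.mem_bot, ← rung_of_le le_rfl, rung_length] at h2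
  rw [← hs, hc, smul_add, h2, add_zero, ← mul_smul, ← Algebra.commutes, mul_smul, h0, smul_zero]

end IsLadder

/-! ### Top elements -/

theorem arrowRadical_le_jacobson (hI : IsAdmissible I) {r : PathAlgebra K V ⧸ I}
    (hr : r ∈ arrowRadical I) : r ∈ Ring.jacobson (PathAlgebra K V ⧸ I) := by
  rw [Ring.jacobson_eq_sInf_isMaximal, Submodule.mem_sInf]
  intro m hm
  by_contra hrm
  have hs : IsSimpleModule (PathAlgebra K V ⧸ I) ((PathAlgebra K V ⧸ I) ⧸ m) := by
    rw [isSimpleModule_iff_isCoatom]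
    exact Ideal.isMaximal_def.1 hm
  have := arrowRadical_smul_eq_zero hI hr (Submodule.Quotient.mk (p := m) 1)
  rw [← Submodule.Quotient.mk_smul, smul_eq_mul, mul_one, Submodule.Quotient.mk_eq_zero] at this
  exact hrm this

namespace IsLadder

variable (h : IsLadder I p x)
include h

/-- Here `J U` is the span of rung 1: that span is a maximal submodule, and rung 1 is a radical
multiple of `x`. An element fixed by an idempotent `e ≠ a` loses its scalar multiple of `x` and so
lies in `J U`. -/
theorem isTopElement_iff (hI : IsAdmissible I) {x' : U} : IsTopElement I x' ↔ IsLadder I p x' := by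
  have hjac : Ring.jacobson (PathAlgebra K V ⧸ I) • (⊤ : Submodule (PathAlgebra K V ⧸ I) U) =
      rungSpan I p x 1 := by
    apply le_antisymm
    · refine (Ring.jacobson_smul_top_le _ _).trans (sInf_le ?_)
      have := h.rungSpan_covBy hI (i := 0) (Nat.zero_le _)
      rw [h.rungSpan_zero, covBy_top_iff] at this
      exact this
    · rw [rungSpan_le_iff]
      obtain ⟨r, hr, hr'⟩ := exists_rung_succ (I := I) (p := p) (x := x) 0
      rw [hr']
      exact Submodule.smul_mem_smul (arrowRadical_le_jacobson hI hr) Submodule.mem_top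
  rw [IsTopElement, hjac]
  constructor
  · rintro ⟨hx', e, he⟩
    refine h.of_notMem hI ?_ hx'
    by_cases hea : e = a
    · rwa [← hea]
    · exfalso
      apply hx'
      have hx0 : x' ∈ Submodule.span (PathAlgebra K V ⧸ I) {x} := h.span_eq_top ▸ Submodule.mem_top
      obtain ⟨s, hs⟩ := Submodule.mem_span_singleton.1 hx0
      obtain ⟨c, r, hr, hc⟩ := exists_smul_eq_of_vertexClass_smul h.vertex s
      rw [← he, ← hs, hc, smul_add, ← mul_smul, ← Algebra.commutes, mul_smul,
        pathClass_smul_eq_zero_of_ne _ h.vertex hea, smul_zero, zero_add]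
      exact Submodule.smul_mem _ _
        (h.smul_mem (i := 0) (h.rungSpan_zero ▸ Submodule.mem_top) hr)
  · intro h'
    refine ⟨fun hm => ?_, a, h'.vertex⟩
    apply h'.ne_zero
    have h2 := h.seg_smul_mem hm le_rfl
    rwa [rungSpan_of_lt (by omega), Submodule.mem_bot, ← rung_of_le le_rfl, rung_length] at h2

end IsLadder

end Ladders

/-! ### Subpaths of masts -/

section Subpaths

variable {K : Type u} {V : Type v} [Field K] [Quiver.{w} V] [Fintype V]
  {I : Ideal (PathAlgebra K V)} [I.IsTwoSided]

/-! ### Factor modules and submodules of a uniserial module attached to subpaths of its mast -/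

section Modules

variable {a b c : V} {p : Quiver.Path a b} {q : Quiver.Path b c}
  {U : Type*} [AddCommGroup U] [Module (PathAlgebra K V ⧸ I) U] {x : U}

theorem IsLadder.isLadder_quotient (hI : IsAdmissible I) (h : IsLadder I (p.comp q) x) :
    IsLadder I p ((rungSpan I (p.comp q) x (p.length + 1)).mkQ x) := by
  have hlen := Quiver.Path.length_comp p q
  have hr {i : ℕ} (hi : i ≤ p.length + 1) :
      rung I p ((rungSpan I (p.comp q) x (p.length + 1)).mkQ x) i =
        (rungSpan I (p.comp q) x (p.length + 1)).mkQ (rung I (p.comp q) x i) := by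
    rcases hi.lt_or_eq with hi' | rfl
    · rw [rung_of_le (by omega), ← map_smul]
      have hs : IsRightSubpath (seg p i) (p.comp q) := by
        obtain ⟨r, hr⟩ := exists_comp_seg p i
        exact ⟨r.comp q, by rw [← Quiver.Path.comp_assoc, ← hr]⟩
      rw [hs.smul_eq_rung, length_seg p (by omega)]
    · rw [rung_of_lt (by omega), eq_comm, Submodule.mkQ_apply, Submodule.Quotient.mk_eq_zero]
      exact rung_mem _
  refine ⟨?_, ?_, ?_, fun i hi r hr' => ?_⟩
  · rw [← map_smul, h.vertex]
  · rw [← rung_length, hr (by omega), Submodule.mkQ_apply, Ne, Submodule.Quotient.mk_eq_zero]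
    exact rung_notMem_rungSpan_succ hI h.ne_zero (by omega)
  · rw [← Set.image_singleton, ← Submodule.map_span, h.span_eq_top, Submodule.map_top,
      Submodule.range_mkQ]
  · rw [hr (by omega), mem_rungSpan, hr (by omega)]
    obtain ⟨s, hs⟩ := mem_rungSpan.1 (h.step i (by omega) r hr')
    exact ⟨s, by rw [← map_smul, hs, map_smul]⟩

theorem IsLadder.isLadder_submodule (h : IsLadder I (p.comp q) x) :
    IsLadder I q (⟨_, rung_mem p.length⟩ : rungSpan I (p.comp q) x p.length) := by
  have hlen := Quiver.Path.length_comp p q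
  have hp : rung I (p.comp q) x p.length = pathClass I p • x :=
    (IsRightSubpath.smul_eq_rung ⟨q, rfl⟩).symm
  have hr (i : ℕ) :
      ((rung I q (⟨_, rung_mem p.length⟩ : rungSpan I (p.comp q) x p.length) i :
        rungSpan I (p.comp q) x p.length) : U) = rung I (p.comp q) x (p.length + i) := by
    by_cases hi : i ≤ q.length
    · have hs : IsRightSubpath (p.comp (seg q i)) (p.comp q) := by
        obtain ⟨r, hr⟩ := exists_comp_seg q i
        exact ⟨r, by rw [Quiver.Path.comp_assoc, ← hr]⟩
      rw [rung_of_le hi, Submodule.coe_smul]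
      change pathClass I (seg q i) • rung I (p.comp q) x p.length = _
      rw [hp, ← mul_smul, ← pathClass_comp, hs.smul_eq_rung, Quiver.Path.length_comp,
        length_seg q hi]
    · rw [rung_of_lt (by omega), rung_of_lt (by omega), Submodule.coe_zero]
  refine ⟨?_, ?_, ?_, fun i hi r hr' => ?_⟩
  · ext
    change vertexClass I b • rung I (p.comp q) x p.length = rung I (p.comp q) x p.length
    rw [hp, vertexClass_smul_pathClass_smul]
  · rw [← rung_length, Ne, ← Submodule.coe_eq_zero, hr, ← hlen, rung_length]
    exact h.ne_zero
  · rw [eq_top_iff]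
    rintro ⟨z, hz⟩ -
    obtain ⟨s, rfl⟩ := mem_rungSpan.1 hz
    exact Submodule.mem_span_singleton.2 ⟨s, rfl⟩
  · obtain ⟨s, hs⟩ := mem_rungSpan.1 (h.step (p.length + i) (by omega) r hr')
    exact mem_rungSpan.2 ⟨s, by ext; rw [Submodule.coe_smul, Submodule.coe_smul, hr, hr, ← hs]; rfl⟩

end Modules

theorem IsMast.of_comp_left (hI : IsAdmissible I) {a b c : V} {p : Quiver.Path a b}
    {q : Quiver.Path b c} (h : IsMast I (p.comp q)) : IsMast I p := by
  obtain ⟨U, hU⟩ := h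
  obtain ⟨x, hx⟩ := hU.exists_isLadder hI
  exact ⟨ModuleCat.of _ _, (hx.isLadder_quotient hI).isMastOf hI⟩

theorem IsMast.of_comp_right (hI : IsAdmissible I) {a b c : V} {p : Quiver.Path a b}
    {q : Quiver.Path b c} (h : IsMast I (p.comp q)) : IsMast I q := by
  obtain ⟨U, hU⟩ := h
  obtain ⟨x, hx⟩ := hU.exists_isLadder hI
  exact ⟨ModuleCat.of _ _, hx.isLadder_submodule.isMastOf hI⟩

/-- This is what allows condition (N) to be applied to arbitrary segments of `p`. -/
theorem IsMast.of_seg_eq_comp (hI : IsAdmissible I) {a b : V} {p : Quiver.Path a b}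
    (h : IsMast I p) {i j : ℕ} {q : Quiver.Path (vtx p i) (vtx p j)}
    (hq : seg p j = (seg p i).comp q) : IsMast I q := by
  obtain ⟨r, hr⟩ := exists_comp_seg p j
  rw [hr] at h
  have := h.of_comp_left hI
  rw [hq] at this
  exact this.of_comp_right hI

/-! ### Consequences of condition (N) -/

/-- The arrow of `p` at position `i` is itself a mast, of length one; a path of length one that
starts or ends in `β` equals `β`. -/
theorem ConditionN.seg_succ_eq_cons (hN : ConditionN I) (hI : IsAdmissible I) {a b : V}
    {p : Quiver.Path a b} (h : IsMast I p) {i : ℕ} (hi : i < p.length)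
    (β : vtx p i ⟶ vtx p (i + 1)) : seg p (i + 1) = (seg p i).cons β := by
  obtain ⟨α, hα⟩ := exists_seg_succ p hi
  have hm : IsMast I α.toPath :=
    h.of_seg_eq_comp hI (i := i) (j := i + 1) (by rw [Quiver.Path.comp_toPath_eq_cons, hα])
  rw [hα]
  rcases hN _ _ β _ (by rw [Quiver.Path.length_toPath]; exact one_pos) hm with ⟨c, hc⟩ | ⟨c, hc⟩
  · have hl := congrArg Quiver.Path.length hc
    rw [Quiver.Path.length_comp, Quiver.Path.length_toPath, Quiver.Path.length_toPath] at hl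
    obtain rfl := c.eq_nil_of_length_zero (by omega)
    rw [← Quiver.Path.comp_toPath_eq_cons, hc]
    rfl
  · have hl := congrArg Quiver.Path.length hc
    rw [Quiver.Path.length_comp, Quiver.Path.length_toPath, Quiver.Path.length_toPath] at hl
    obtain rfl := c.eq_nil_of_length_zero (by omega)
    rw [← Quiver.Path.comp_toPath_eq_cons, hc, Quiver.Path.nil_comp]
    rfl

theorem ConditionN.eq_of_vtx_eq (hN : ConditionN I) (hI : IsAdmissible I) {a b : V}
    {p : Quiver.Path a b} (h : IsMast I p) {a' b' : V} {q : Quiver.Path a' b'}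
    (hl : q.length = p.length) (hv : ∀ i ≤ p.length, vtx q i = vtx p i) :
    (⟨a', b', q⟩ : QuiverPath V) = ⟨a, b, p⟩ := by
  obtain rfl : a' = a := by rw [← vtx_zero q, hv 0 (Nat.zero_le _), vtx_zero]
  have key {i : ℕ} (hi : i ≤ p.length) : initPath q i = initPath p i := by
    induction i with
    | zero => rw [initPath_zero, initPath_zero]
    | succ i ih =>
      obtain ⟨β, hβ⟩ := exists_seg_succ q (i := i) (by omega)
      rw [initPath_eq q, hβ]
      -- Stated for an arbitrary pair `s`, so that the inductive equality of pairs can be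
      -- substituted although the end vertices differ syntactically.
      have claim : ∀ (s : Σ c : V, Quiver.Path a' c) (d : V) (β' : s.1 ⟶ d),
          s = ⟨vtx p i, seg p i⟩ → d = vtx p (i + 1) →
            (⟨d, s.2.cons β'⟩ : Σ c : V, Quiver.Path a' c) = initPath p (i + 1) := by
        rintro s d β' rfl rfl
        rw [initPath_eq p (i + 1), hN.seg_succ_eq_cons hI h hi β']
      exact claim ⟨vtx q i, seg q i⟩ _ β (ih (by omega)) (hv _ hi)
  have h1 := key le_rfl
  rw [initPath_of_le p le_rfl, initPath_of_le q hl.le] at h1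
  exact congrArg (fun s : Σ c : V, Quiver.Path a' c => (⟨a', s.1, s.2⟩ : QuiverPath V)) h1

/-! ### Composition factors -/

theorem passesThrough_iff {l : ℕ} {S : Fin (l + 1) → ModuleCat.{max u v w} (PathAlgebra K V ⧸ I)}
    {a b : V} {p : Quiver.Path a b} : PassesThrough I S p ↔
      p.length = l ∧ ∀ i : Fin (l + 1), ∃ x : S i, vertexClass I (vtx p i) • x ≠ 0 := by
  constructor
  · rintro ⟨rfl, e, he, hx⟩
    rw [vertices_eq_ofFn] at he
    obtain rfl := List.ofFn_injective he
    exact ⟨rfl, hx⟩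
  · rintro ⟨rfl, hx⟩
    exact ⟨rfl, _, vertices_eq_ofFn p, hx⟩

theorem nonempty_linearEquiv_of_isSimpleModule (hI : IsAdmissible I) {T T' : Type*}
    [AddCommGroup T] [Module (PathAlgebra K V ⧸ I) T] [IsSimpleModule (PathAlgebra K V ⧸ I) T]
    [AddCommGroup T'] [Module (PathAlgebra K V ⧸ I) T'] [IsSimpleModule (PathAlgebra K V ⧸ I) T']
    {e : V} {t : T} {t' : T'} (h : vertexClass I e • t ≠ 0) (h' : vertexClass I e • t' ≠ 0) :
    Nonempty (T ≃ₗ[PathAlgebra K V ⧸ I] T') :=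
  nonempty_linearEquiv_of_forall_smul_eq_zero_iff
    (IsSimpleModule.span_singleton_eq_top _ h) (IsSimpleModule.span_singleton_eq_top _ h')
    (smul_eq_zero_iff_of_arrowRadical (vertexClass_smul_pathClass_smul _ _)
      (vertexClass_smul_pathClass_smul _ _) h h' (fun _ hr => arrowRadical_smul_eq_zero hI hr _)
      fun _ hr => arrowRadical_smul_eq_zero hI hr _)

section Factors

variable {U : Type*} [AddCommGroup U] [Module (PathAlgebra K V ⧸ I) U]

theorem smul_mem_of_covBy (hI : IsAdmissible I) {A B : Submodule (PathAlgebra K V ⧸ I) U}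
    (h : A ⋖ B) {z : U} (hz : z ∈ B) {r : PathAlgebra K V ⧸ I} (hr : r ∈ arrowRadical I) :
    r • z ∈ A := by
  have : IsSimpleModule (PathAlgebra K V ⧸ I) (B ⧸ A.submoduleOf B) :=
    (covBy_iff_quot_is_simple h.le).1 h
  have h0 := arrowRadical_smul_eq_zero hI hr ((A.submoduleOf B).mkQ ⟨z, hz⟩)
  rw [← map_smul, Submodule.mkQ_apply, Submodule.Quotient.mk_eq_zero] at h0
  exact h0

theorem eq_of_vertexClass_smul_notMem (hI : IsAdmissible I)
    {A B : Submodule (PathAlgebra K V ⧸ I) U} (h : A ⋖ B) {z z' : U} (hz : z ∈ B) (hz' : z' ∈ B)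
    {e e' : V} (he : vertexClass I e • z ∉ A) (he' : vertexClass I e' • z' ∉ A) : e = e' := by
  have : IsSimpleModule (PathAlgebra K V ⧸ I) (B ⧸ A.submoduleOf B) :=
    (covBy_iff_quot_is_simple h.le).1 h
  refine eq_of_vertexClass_smul_ne_zero hI (t := (A.submoduleOf B).mkQ ⟨z, hz⟩)
    (t' := (A.submoduleOf B).mkQ ⟨z', hz'⟩) ?_ ?_
  · rw [← map_smul, Submodule.mkQ_apply, Ne, Submodule.Quotient.mk_eq_zero]
    exact he
  · rw [← map_smul, Submodule.mkQ_apply, Ne, Submodule.Quotient.mk_eq_zero]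
    exact he'

theorem IsUniserial.eq_span_of_covBy {R M : Type*} [Ring R] [AddCommGroup M] [Module R M]
    (hu : IsUniserial R M) {A B : Submodule R M} (h : A ⋖ B) {z : M} (hz : z ∈ B) (hz' : z ∉ A) :
    B = Submodule.span R {z} := by
  have h1 : Submodule.span R {z} ≤ B := (Submodule.span_singleton_le_iff_mem _ _).2 hz
  have h2 : A < Submodule.span R {z} := by
    have : ¬ Submodule.span R {z} ≤ A := fun h' =>
      hz' ((Submodule.span_singleton_le_iff_mem _ _).1 h')
    exact lt_of_le_not_ge ((hu _ _).resolve_left this) this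
  by_contra hne
  exact h.2 h2 (lt_of_le_of_ne h1 (Ne.symm hne))

/-- The rungs are shown to generate the layers one after another. Some arrow must carry rung `i`
outside `G (i + 2)`, its target must be the vertex of the layer `G (i + 1) / G (i + 2)`, and (N)
then identifies it with the next arrow of `p`. -/
theorem isMastOf_of_chain (hN : ConditionN I) (hI : IsAdmissible I) {a b : V} {p : Quiver.Path a b}
    (hp : IsMast I p) (hu : IsUniserial (PathAlgebra K V ⧸ I) U)
    {G : ℕ → Submodule (PathAlgebra K V ⧸ I) U} (h0 : G 0 = ⊤) (hl : G (p.length + 1) = ⊥)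
    (hcov : ∀ i ≤ p.length, G (i + 1) ⋖ G i)
    (hvert : ∀ i ≤ p.length, ∃ z ∈ G i, vertexClass I (vtx p i) • z ∉ G (i + 1)) :
    IsMastOf I p U := by
  obtain ⟨z, hz, hx⟩ := hvert 0 (Nat.zero_le _)
  rw [vtx_zero] at hx
  have hvx := vertexClass_smul_pathClass_smul (I := I) (Quiver.Path.nil : Quiver.Path a a) z
  set x := vertexClass I a • z with hxdef
  have key : ∀ i ≤ p.length, rung I p x i ∈ G i ∧ rung I p x i ∉ G (i + 1) := by
    intro i
    induction i with
    | zero =>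
      intro _
      rw [rung_zero hvx, h0]
      exact ⟨Submodule.mem_top, hx⟩
    | succ i ih =>
      intro hi
      obtain ⟨h1, h2⟩ := ih (by omega)
      have hspan := hu.eq_span_of_covBy (hcov i (by omega)) h1 h2
      obtain ⟨e', β, hβ⟩ : ∃ (e' : V) (β : vtx p i ⟶ e'),
          pathClass I β.toPath • rung I p x i ∉ G (i + 2) := by
        -- Otherwise the radical maps rung `i` into `G (i + 2)`. An element of `G (i + 1)` has zero
        -- scalar part with respect to rung `i`, so it would lie in `G (i + 2)`.
        by_contra! hall
        apply (hcov (i + 1) hi).lt.not_ge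
        intro w hw
        have hw' := (hcov i (by omega)).le hw
        rw [hspan] at hw'
        obtain ⟨s, hs⟩ := Submodule.mem_span_singleton.1 hw'
        obtain ⟨c, r, hr, hc⟩ := exists_smul_eq_of_vertexClass_smul
          (vertexClass_smul_rung (I := I) (p := p) (x := x) i) s
        have hr' := arrowRadical_smul_mem (vertexClass_smul_rung i) hall hr
        rw [hs] at hc
        by_cases hc0 : c = 0
        · rw [hc0, map_zero, zero_smul, zero_add] at hc
          rwa [hc]
        · exfalso
          apply h2
          have h3 : algebraMap K (PathAlgebra K V ⧸ I) c • rung I p x i ∈ G (i + 1) := by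
            rw [← sub_eq_iff_eq_add.2 hc]
            exact sub_mem hw ((hcov (i + 1) hi).le hr')
          have := (G (i + 1)).smul_mem (algebraMap K (PathAlgebra K V ⧸ I) c⁻¹) h3
          rwa [← mul_smul, ← map_mul, inv_mul_cancel₀ hc0, map_one, one_smul] at this
      have h3 : pathClass I β.toPath • rung I p x i ∈ G (i + 1) :=
        smul_mem_of_covBy hI (hcov i (by omega)) h1 (pathClass_mem_arrowRadical le_rfl)
      obtain ⟨z', hz', hvz'⟩ := hvert (i + 1) hi
      obtain rfl : e' = vtx p (i + 1) :=
        eq_of_vertexClass_smul_notMem hI (hcov (i + 1) hi) h3 hz'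
          (by rwa [vertexClass_smul_pathClass_smul]) hvz'
      rw [rung_succ β (hN.seg_succ_eq_cons hI hp hi β) hi]
      exact ⟨h3, hβ⟩
  have hG : ∀ i ≤ p.length, G i = rungSpan I p x i := fun i hi =>
    hu.eq_span_of_covBy (hcov i hi) (key i hi).1 (key i hi).2
  refine IsLadder.isMastOf (x := x) ⟨hvx, ?_, ?_, fun i hi r hr => ?_⟩ hI
  · have := (key _ le_rfl).2
    rw [hl, Submodule.mem_bot, rung_length] at this
    exact this
  · rw [← h0, hG 0 (Nat.zero_le _), rungSpan, rung_zero hvx]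
  · have h1 := smul_mem_of_covBy hI (hcov i hi) (key i hi).1 hr
    rcases hi.lt_or_eq with hi' | rfl
    · rwa [← hG _ hi']
    · rwa [hl, ← rungSpan_of_lt (I := I) (p := p) (x := x) (Nat.lt_succ_self _)] at h1

end Factors

theorem isUniserialWithFactors_iff (hN : ConditionN I) (hI : IsAdmissible I) {l : ℕ}
    {S : Fin (l + 1) → ModuleCat.{max u v w} (PathAlgebra K V ⧸ I)}
    (hS : ∀ i, IsSimpleModule (PathAlgebra K V ⧸ I) (S i)) {a b : V} {p : Quiver.Path a b}
    (hp : PassesThrough I S p) (hm : IsMast I p) {U : Type (max u v w)} [AddCommGroup U]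
    [Module (PathAlgebra K V ⧸ I) U] : IsUniserialWithFactors S U ↔ IsMastOf I p U := by
  obtain ⟨rfl, hv⟩ := passesThrough_iff.1 hp
  constructor
  · rintro ⟨hu, F, hF, h0, hl, hQ⟩
    have hcov (i : Fin (p.length + 1)) : F i.succ ⋖ F i.castSucc := by
      obtain ⟨f⟩ := hQ i
      rw [covBy_iff_quot_is_simple (hF (Fin.castSucc_le_succ i))]
      exact IsSimpleModule.congr f
    -- The filtration is extended by `⊥` to all natural numbers to match the indexing of the rungs.
    let G : ℕ → Submodule (PathAlgebra K V ⧸ I) U := fun i =>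
      if h : i < p.length + 2 then F ⟨i, h⟩ else ⊥
    have hGc (i : Fin (p.length + 1)) : G i = F i.castSucc := dif_pos (by omega)
    have hGs (i : Fin (p.length + 1)) : G (i + 1) = F i.succ := dif_pos (by omega)
    refine isMastOf_of_chain hN hI hm hu (G := G) ?_ ?_ (fun i hi => ?_) fun i hi => ?_
    · rw [← h0]
      exact dif_pos (by omega)
    · rw [← hl]
      exact dif_pos (by omega)
    · have := hcov ⟨i, by omega⟩
      rwa [← hGc, ← hGs] at this
    · obtain ⟨f⟩ := hQ ⟨i, by omega⟩
      obtain ⟨t, ht⟩ := hv ⟨i, by omega⟩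
      obtain ⟨⟨z, hz⟩, hzt⟩ := Submodule.mkQ_surjective _ (f.symm t)
      refine ⟨z, (hGc ⟨i, by omega⟩).symm ▸ hz, fun hmem => ht ?_⟩
      have h1 : f.symm (vertexClass I (vtx p i) • t) = 0 := by
        rw [map_smul, ← hzt, ← map_smul, Submodule.mkQ_apply, Submodule.Quotient.mk_eq_zero]
        have h2 := hGs ⟨i, by omega⟩
        rw [h2] at hmem
        exact hmem
      exact f.symm.map_eq_zero_iff.1 h1
  · intro hU
    obtain ⟨x, hx⟩ := hU.exists_isLadder hI
    refine ⟨hU.1, fun i => rungSpan I p x i, fun i j hij => rungSpan_antitone hij,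
      hx.rungSpan_zero, rungSpan_of_lt (Nat.lt_succ_self _), fun i => ?_⟩
    have hi : (i : ℕ) ≤ p.length := by omega
    have hcov := hx.rungSpan_covBy hI hi
    have hs : IsSimpleModule (PathAlgebra K V ⧸ I)
        (rungSpan I p x i ⧸ (rungSpan I p x (i + 1)).submoduleOf (rungSpan I p x i)) :=
      (covBy_iff_quot_is_simple hcov.le).1 hcov
    have := hS i
    obtain ⟨t, ht⟩ := hv i
    refine @nonempty_linearEquiv_of_isSimpleModule K V _ _ _ I _ hI
      (rungSpan I p x i ⧸ (rungSpan I p x (i + 1)).submoduleOf (rungSpan I p x i)) (S i)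
      _ _ hs _ _ this (vtx p i)
      (((rungSpan I p x (i + 1)).submoduleOf (rungSpan I p x i)).mkQ ⟨_, rung_mem _⟩) t ?_ ht
    rw [← map_smul, Submodule.mkQ_apply, Ne, Submodule.Quotient.mk_eq_zero]
    intro hmem
    have hmem' : vertexClass I (vtx p i) • rung I p x i ∈ rungSpan I p x (i + 1) := hmem
    rw [vertexClass_smul_rung] at hmem'
    exact rung_notMem_rungSpan_succ hI hx.ne_zero hi hmem'

end Subpaths

/-! ### Self-extensions of simple modules -/

section Extensions

-- Apply `Ext(-, T)` to `0 → ker → R → T → 0`. As `R` is projective, each class in `Ext¹` is a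
-- connecting image of some `f : ker → T`, and this image vanishes when `f` extends to `R`.
open CategoryTheory in
theorem subsingleton_ext_one_of_forall_exists {R : Type u} [Ring R] {T : ModuleCat.{u} R} {t : T}
    (ht : Submodule.span R {t} = ⊤)
    (h : ∀ f : LinearMap.ker (LinearMap.toSpanSingleton R T t) →ₗ[R] T,
      ∃ g : R →ₗ[R] T, ∀ z, f z = g z) :
    Subsingleton (Abelian.Ext.{u} T T 1) := by
  refine subsingleton_of_forall_eq 0 fun x => ?_
  have hX := LinearMap.shortExact_shortComplexKer (f := LinearMap.toSpanSingleton R T t) (by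
    rw [← LinearMap.range_eq_top, LinearMap.range_toSpanSingleton, ht])
  have : Projective (ModuleCat.of R R) :=
    ModuleCat.projective_of_free (Module.Basis.singleton Unit R)
  obtain ⟨y, hy⟩ := Abelian.Ext.contravariant_sequence_exact₃ hX T x
    (Abelian.Ext.eq_zero_of_projective (P := ModuleCat.of R R) _) (n₀ := 0) rfl
  obtain ⟨f, rfl⟩ := Abelian.Ext.addEquiv₀.symm.surjective y
  obtain ⟨g, hg⟩ := h f.hom
  have hf : f = (LinearMap.toSpanSingleton R T t).shortComplexKer.f ≫ ModuleCat.ofHom g := by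
    ext z
    exact hg z
  have hf' : Abelian.Ext.addEquiv₀.symm f =
      (Abelian.Ext.mk₀ (LinearMap.toSpanSingleton R T t).shortComplexKer.f).comp
        (Abelian.Ext.mk₀ (ModuleCat.ofHom g)) (zero_add 0) := by
    rw [Abelian.Ext.mk₀_comp_mk₀, ← hf]
    rfl
  rw [← hy, hf', ShortComplex.ShortExact.extClass_comp_assoc]

variable {K : Type u} {V : Type v} [Field K] [Quiver.{w} V] [Fintype V]
  {I : Ideal (PathAlgebra K V)} [I.IsTwoSided]

/-- A simple module with a nontrivial self-extension sits at a vertex carrying a loop. -/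
theorem nonempty_loop_of_nontrivial_ext (hI : IsAdmissible I)
    {T : ModuleCat.{max u v w} (PathAlgebra K V ⧸ I)} [IsSimpleModule (PathAlgebra K V ⧸ I) T]
    {e : V} {t : T} (ht : vertexClass I e • t ≠ 0)
    (h : Nontrivial (CategoryTheory.Abelian.Ext.{max u v w} T T 1)) : Nonempty (e ⟶ e) := by
  by_contra hloop
  rw [← not_subsingleton_iff_nontrivial] at h
  apply h
  have hv := vertexClass_smul_pathClass_smul (I := I) (Quiver.Path.nil : Quiver.Path e e) t
  set s := vertexClass I e • t
  refine subsingleton_ext_one_of_forall_exists (IsSimpleModule.span_singleton_eq_top _ ht)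
    fun f => ?_
  have hmem {z : PathAlgebra K V ⧸ I} : z ∈ LinearMap.ker (LinearMap.toSpanSingleton _ T s) ↔
      z • s = 0 := Iff.rfl
  have h1 : (1 - vertexClass I e) ∈ LinearMap.ker (LinearMap.toSpanSingleton _ T s) := by
    rw [hmem, sub_smul, hv, one_smul, sub_self]
  -- Split `z = z e + z (1 - e)`. The second summand forces the extension to send `1` to `f (1 -
  -- e)`, and it remains to show `f (z e) = 0`.
  refine ⟨LinearMap.toSpanSingleton _ T (f ⟨_, h1⟩), fun z => ?_⟩
  obtain ⟨c, r, hr, hz⟩ := mul_vertexClass_eq z.1 e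
  have hc : c = 0 := (smul_eq_zero_iff_coeff_eq_zero hz hv ht
    (arrowRadical_smul_eq_zero hI hr _)).1 (hmem.1 z.2)
  have harrow : r • vertexClass I e ∈ (LinearMap.ker f).map (Submodule.subtype _) := by
    refine arrowRadical_smul_mem (e := e) (vertexClass_mul_pathClass I _) (fun e' β => ?_) hr
    have hβ : pathClass I β.toPath ∈ LinearMap.ker (LinearMap.toSpanSingleton _ T s) :=
      hmem.2 (arrowRadical_smul_eq_zero hI (pathClass_mem_arrowRadical le_rfl) _)
    refine ⟨⟨_, hβ⟩, ?_, (pathClass_mul_vertexClass I _).symm⟩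
    -- Without loops at `e`, the value of `f` on an arrow `e ⟶ e'` is supported at `e' ≠ e`, where
    -- `T` has nothing.
    have hee : e' ≠ e := by
      rintro rfl
      exact hloop ⟨β⟩
    have h2 : f ⟨_, hβ⟩ = vertexClass I e' • f ⟨_, hβ⟩ := by
      rw [← map_smul]
      congr 1
      exact Subtype.ext (vertexClass_mul_pathClass I _).symm
    change f ⟨_, hβ⟩ = 0
    rw [h2]
    by_contra h3
    exact hee (eq_of_vertexClass_smul_ne_zero hI h3 ht)
  obtain ⟨y, hy, hyz⟩ := harrow
  have hy' : (y : PathAlgebra K V ⧸ I) = z.1 * vertexClass I e := by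
    rw [hz, hc, zero_smul, zero_add]
    exact hyz
  have hsum : z = y + z.1 • ⟨_, h1⟩ := by
    ext
    rw [Submodule.coe_add, Submodule.coe_smul, hy', smul_eq_mul, mul_sub, mul_one]
    abel
  have hfy : f y = 0 := hy
  rw [LinearMap.toSpanSingleton_apply]
  conv_lhs => rw [hsum, map_add, hfy, zero_add, map_smul]

end Extensions

/-! ### Coordinates with respect to a ladder -/

section Coordinates

variable {K : Type u} {V : Type v} [Field K] [Quiver.{w} V] [Fintype V]
  {I : Ideal (PathAlgebra K V)} [I.IsTwoSided] {a b : V} {p : Quiver.Path a b}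
  {U : Type*} [AddCommGroup U] [Module (PathAlgebra K V ⧸ I) U] {x : U}

theorem vertexClass_smul_rung_of_ne {e : V} {i : ℕ} (h : vtx p i ≠ e) :
    vertexClass I e • rung I p x i = 0 :=
  pathClass_smul_eq_zero_of_ne _ (vertexClass_smul_rung i) (Ne.symm h)

theorem algebraMap_smul_comm (c : K) (r : PathAlgebra K V ⧸ I) (y : U) :
    r • algebraMap K (PathAlgebra K V ⧸ I) c • y =
      algebraMap K (PathAlgebra K V ⧸ I) c • r • y := by
  rw [← mul_smul, ← mul_smul, Algebra.commutes]

namespace IsLadder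

variable (h : IsLadder I p x)
include h

/-- Split off the scalar multiple of the leading rung; the radical remainder lies one step further
down. -/
theorem exists_coeff {i : ℕ} {z : U} (hz : z ∈ rungSpan I p x i) :
    ∃ c : ℕ → K, z = ∑ j ∈ Finset.Ico i (p.length + 1),
      algebraMap K (PathAlgebra K V ⧸ I) (c j) • rung I p x j := by
  by_cases hi : p.length < i
  · rw [rungSpan_of_lt hi, Submodule.mem_bot] at hz
    exact ⟨0, by rw [hz, Finset.Ico_eq_empty (by omega), Finset.sum_empty]⟩
  obtain ⟨n, hn⟩ := Nat.exists_eq_add_of_le (not_lt.1 hi)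
  induction n generalizing i z with
  | zero =>
    obtain ⟨s, rfl⟩ := mem_rungSpan.1 hz
    obtain ⟨c, r, hr, hc⟩ := exists_smul_eq_of_vertexClass_smul
      (vertexClass_smul_rung (I := I) (p := p) (x := x) i) s
    have h1 := h.step i (by omega) r hr
    rw [rungSpan_of_lt (by omega), Submodule.mem_bot] at h1
    refine ⟨fun _ => c, ?_⟩
    rw [hc, h1, add_zero, hn, add_zero, Nat.Ico_succ_singleton, Finset.sum_singleton]
  | succ n ih =>
    obtain ⟨s, rfl⟩ := mem_rungSpan.1 hz
    obtain ⟨c, r, hr, hc⟩ := exists_smul_eq_of_vertexClass_smul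
      (vertexClass_smul_rung (I := I) (p := p) (x := x) i) s
    obtain ⟨d, hd⟩ := ih (h.step i (by omega) r hr) (by omega) (by omega)
    refine ⟨Function.update d i c, ?_⟩
    rw [Finset.sum_eq_sum_Ico_succ_bot (by omega), Function.update_self, hc, hd]
    congr 1
    refine Finset.sum_congr rfl fun j hj => ?_
    rw [Finset.mem_Ico] at hj
    rw [Function.update_of_ne (by omega)]

open Classical in
theorem exists_coeff_vertex {i : ℕ} {z : U} (hz : z ∈ rungSpan I p x i) {e : V}
    (he : vertexClass I e • z = z) :
    ∃ c : ℕ → K, z = ∑ j ∈ Finset.Ico i (p.length + 1) with vtx p j = e,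
      algebraMap K (PathAlgebra K V ⧸ I) (c j) • rung I p x j := by
  obtain ⟨c, hc⟩ := h.exists_coeff hz
  refine ⟨c, ?_⟩
  rw [Finset.sum_filter, ← he, hc, Finset.smul_sum]
  refine Finset.sum_congr rfl fun j _ => ?_
  rw [algebraMap_smul_comm]
  split_ifs with hj
  · rw [← hj, vertexClass_smul_rung]
  · rw [vertexClass_smul_rung_of_ne hj, smul_zero]

/-- The basic vanishing criterion: an element at vertex `e` is a combination of the remaining rungs
at `e`, so it is zero once `p` no longer returns to `e`. -/
theorem eq_zero_of_forall_vtx_ne {i : ℕ} {z : U} (hz : z ∈ rungSpan I p x i) {e : V}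
    (he : vertexClass I e • z = z) (hv : ∀ j, i ≤ j → j ≤ p.length → vtx p j ≠ e) : z = 0 := by
  classical
  obtain ⟨c, hc⟩ := h.exists_coeff_vertex hz he
  rw [hc]
  refine Finset.sum_eq_zero fun j hj => ?_
  rw [Finset.mem_filter, Finset.mem_Ico] at hj
  exact absurd hj.2 (hv j hj.1.1 (by omega))

theorem exists_eq_smul_rung {i m : ℕ} {z : U} (hz : z ∈ rungSpan I p x i) {e : V}
    (he : vertexClass I e • z = z) (hv : ∀ j, i ≤ j → j ≤ p.length → vtx p j = e → j = m) :
    ∃ c : K, z = algebraMap K (PathAlgebra K V ⧸ I) c • rung I p x m := by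
  classical
  obtain ⟨c, hc⟩ := h.exists_coeff_vertex hz he
  by_cases hm : m ∈ {j ∈ Finset.Ico i (p.length + 1) | vtx p j = e}
  · refine ⟨c m, hc.trans (Finset.sum_eq_single_of_mem m hm fun j hj hjm => ?_)⟩
    rw [Finset.mem_filter, Finset.mem_Ico] at hj
    exact absurd (hv j hj.1.1 (by omega) hj.2) hjm
  · refine ⟨0, ?_⟩
    rw [map_zero, zero_smul, hc]
    refine Finset.sum_eq_zero fun j hj => absurd ?_ hm
    have hj' := hj
    rw [Finset.mem_filter, Finset.mem_Ico] at hj'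
    rwa [← hv j hj'.1.1 (by omega) hj'.2]

theorem eq_zero_of_smul_rung_mem (hI : IsAdmissible I) {c : K} {i : ℕ} (hi : i ≤ p.length)
    (hc : algebraMap K (PathAlgebra K V ⧸ I) c • rung I p x i ∈ rungSpan I p x (i + 1)) :
    c = 0 := by
  by_contra hc0
  apply rung_notMem_rungSpan_succ hI h.ne_zero hi
  have := Submodule.smul_mem _ (algebraMap K (PathAlgebra K V ⧸ I) c⁻¹) hc
  rwa [← mul_smul, ← map_mul, inv_mul_cancel₀ hc0, map_one, one_smul] at this

/-- The rungs of a ladder are linearly independent. -/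
theorem eq_zero_of_sum_eq_zero (hI : IsAdmissible I) {T : Type*} (s : Finset T) {f : T → ℕ}
    (hf : Function.Injective f) (hl : ∀ t ∈ s, f t ≤ p.length) {c : T → K}
    (hs : ∑ t ∈ s, algebraMap K (PathAlgebra K V ⧸ I) (c t) • rung I p x (f t) = 0) :
    ∀ t ∈ s, c t = 0 := by
  classical
  intro t
  induction hn : f t using Nat.strong_induction_on generalizing t with
  | _ n ih =>
    intro ht
    refine h.eq_zero_of_smul_rung_mem hI (hl t ht) ?_
    rw [← Finset.add_sum_erase s _ ht] at hs
    rw [eq_neg_of_add_eq_zero_left hs]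
    refine neg_mem (sum_mem fun t' ht' => ?_)
    rw [Finset.mem_erase] at ht'
    rcases Nat.lt_or_ge (f t') n with hlt | hge
    · rw [ih _ hlt t' rfl ht'.2, map_zero, zero_smul]
      exact zero_mem _
    · have hne : f t' ≠ f t := fun he => ht'.1 (hf he)
      exact Submodule.smul_mem _ _ (rungSpan_antitone (by omega) (rung_mem _))

end IsLadder

/-! ### Realizations of points of the variety -/

theorem smul_rung_of_isRightSubpath {i : ℕ} (hi : i ≤ p.length) {t : V} {β : vtx p i ⟶ t}
    (h : IsRightSubpath ((seg p i).cons β) p) :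
    pathClass I β.toPath • rung I p x i = rung I p x (i + 1) := by
  have := h.smul_eq_rung (I := I) (x := x)
  rwa [pathClass_cons, mul_smul, Quiver.Path.length_cons, length_seg p hi,
    ← rung_of_le hi] at this

variable (I) in
/-- The coordinates `k` describe the products of `x` with the detours on `p`. -/
def Realizes (k : DetourVar p → K) (x : U) : Prop :=
  ∀ d : Detour p, pathClass I (d.1.stem.cons d.1.arrow) • x =
    ∑ i : DetourIndex d, algebraMap K (PathAlgebra K V ⧸ I) (k ⟨d, i⟩) • pathClass I i.1 • x

theorem Detour.smul_eq (d : Detour p) : pathClass I (d.1.stem.cons d.1.arrow) • x =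
    pathClass I d.1.arrow.toPath • rung I p x d.1.stem.length := by
  rw [pathClass_cons, mul_smul, d.2.1.smul_eq_rung]

theorem realizes_iff {k : DetourVar p → K} : Realizes I k x ↔
    ∀ d : Detour p, pathClass I d.1.arrow.toPath • rung I p x d.1.stem.length =
      ∑ i : DetourIndex d,
        algebraMap K (PathAlgebra K V ⧸ I) (k ⟨d, i⟩) • rung I p x i.1.length := by
  refine forall_congr' fun d => ?_
  rw [d.smul_eq]
  have : ∀ i : DetourIndex d, pathClass I i.1 • x = rung I p x i.1.length :=
    fun i => i.2.1.smul_eq_rung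
  simp only [this]

/-- An arrow sends a rung to a combination of strictly later rungs at its target vertex, and the
positions of these are exactly the index set of the detour. -/
theorem IsLadder.exists_realizes (h : IsLadder I p x) : ∃ k : DetourVar p → K, Realizes I k x := by
  classical
  have key (d : Detour p) : ∃ c : ℕ → K,
      pathClass I d.1.arrow.toPath • rung I p x d.1.stem.length =
        ∑ i : DetourIndex d,
          algebraMap K (PathAlgebra K V ⧸ I) (c i.1.length) • rung I p x i.1.length := by
    obtain ⟨c, hc⟩ := h.exists_coeff_vertex (e := d.1.tgt)
      (h.step _ d.2.1.length_le _ (pathClass_mem_arrowRadical (p := d.1.arrow.toPath) le_rfl))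
      (vertexClass_smul_pathClass_smul _ _)
    exact ⟨c, by rw [hc, ← sum_detourIndex d fun j =>
      algebraMap K (PathAlgebra K V ⧸ I) (c j) • rung I p x j]⟩
  choose c hc using key
  exact ⟨fun t => c t.1 t.2.1.length, realizes_iff.2 hc⟩

theorem mem_uniserialVariety_iff (hI : IsAdmissible I) {k : DetourVar p → K} :
    k ∈ uniserialVariety I p ↔ ∃ U : ModuleCat.{max u v w} (PathAlgebra K V ⧸ I),
      ∃ x : U, IsLadder I p x ∧ Realizes I k x := by
  constructor
  · rintro ⟨U, hU, x, hx, hk⟩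
    obtain ⟨y, hy⟩ := hU.exists_isLadder hI
    exact ⟨U, x, (hy.isTopElement_iff hI).1 hx, hk⟩
  · rintro ⟨U, x, hx, hk⟩
    exact ⟨U, hx.isMastOf hI, x, (hx.isTopElement_iff hI).2 hx, hk⟩

/-! ### Coordinates determine the isomorphism type -/

section Isomorphism

variable {U' : Type*} [AddCommGroup U'] [Module (PathAlgebra K V ⧸ I) U'] {x' : U'}

variable (I p x x') in
/-- Two elements have the same coordinates with respect to two given ladders. -/
def HasCommonCoeff (z : U) (z' : U') : Prop :=
  ∃ c : ℕ → K,
    z = ∑ j ∈ Finset.range (p.length + 1),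
      algebraMap K (PathAlgebra K V ⧸ I) (c j) • rung I p x j ∧
    z' = ∑ j ∈ Finset.range (p.length + 1),
      algebraMap K (PathAlgebra K V ⧸ I) (c j) • rung I p x' j

namespace HasCommonCoeff

theorem zero : HasCommonCoeff I p x x' 0 0 :=
  ⟨0, by simp, by simp⟩

theorem add {z w : U} {z' w' : U'} (hz : HasCommonCoeff I p x x' z z')
    (hw : HasCommonCoeff I p x x' w w') : HasCommonCoeff I p x x' (z + w) (z' + w') := by
  obtain ⟨c, rfl, rfl⟩ := hz
  obtain ⟨d, rfl, rfl⟩ := hw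
  exact ⟨c + d, by simp only [Pi.add_apply, map_add, add_smul, Finset.sum_add_distrib],
    by simp only [Pi.add_apply, map_add, add_smul, Finset.sum_add_distrib]⟩

theorem smul {z : U} {z' : U'} (c : K) (hz : HasCommonCoeff I p x x' z z') :
    HasCommonCoeff I p x x' (algebraMap K (PathAlgebra K V ⧸ I) c • z)
      (algebraMap K (PathAlgebra K V ⧸ I) c • z') := by
  obtain ⟨d, rfl, rfl⟩ := hz
  exact ⟨fun j => c * d j, by simp only [Finset.smul_sum, map_mul, mul_smul],
    by simp only [Finset.smul_sum, map_mul, mul_smul]⟩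

theorem sum {T : Type*} (s : Finset T) {z : T → U} {z' : T → U'}
    (h : ∀ t ∈ s, HasCommonCoeff I p x x' (z t) (z' t)) :
    HasCommonCoeff I p x x' (∑ t ∈ s, z t) (∑ t ∈ s, z' t) := by
  classical
  induction s using Finset.induction_on with
  | empty => exact zero
  | insert t s ht ih =>
    rw [Finset.sum_insert ht, Finset.sum_insert ht]
    exact (h t (Finset.mem_insert_self _ _)).add
      (ih fun t' ht' => h t' (Finset.mem_insert_of_mem ht'))

theorem rung (i : ℕ) : HasCommonCoeff I p x x' (rung I p x i) (rung I p x' i) := by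
  classical
  by_cases hi : i ≤ p.length
  · have hi' : i ∈ Finset.range (p.length + 1) := Finset.mem_range.2 (by omega)
    refine ⟨Pi.single i 1, ?_, ?_⟩ <;>
    · rw [Finset.sum_eq_single_of_mem i hi' fun j _ hj => by
        rw [Pi.single_eq_of_ne hj, map_zero, zero_smul], Pi.single_eq_same, map_one, one_smul]
  · rw [rung_of_lt (by omega), rung_of_lt (by omega)]
    exact zero

end HasCommonCoeff

variable {k : DetourVar p → K}

/-- If `β` starts at the vertex of the rung, it continues `p`, or gives a detour governed by `k`, or
ends in a vertex absent from the rest of `p` and acts as zero. The outcome is the same in both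
modules. -/
theorem hasCommonCoeff_arrow_smul_rung (h : IsLadder I p x) (h' : IsLadder I p x')
    (hk : Realizes I k x) (hk' : Realizes I k x') {m t : V} (β : m ⟶ t) {i : ℕ}
    (hi : i ≤ p.length) :
    HasCommonCoeff I p x x' (pathClass I β.toPath • rung I p x i)
      (pathClass I β.toPath • rung I p x' i) := by
  by_cases hm : m = vtx p i
  · subst hm
    by_cases hsub : IsRightSubpath ((seg p i).cons β) p
    · rw [smul_rung_of_isRightSubpath hi hsub, smul_rung_of_isRightSubpath hi hsub]
      exact .rung _
    by_cases hex : ∃ v : Quiver.Path a t, IsRightSubpath v p ∧ (seg p i).length < v.length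
    · let d : Detour p := ⟨⟨β, seg p i⟩, isRightSubpath_seg p i, hsub, hex⟩
      have hd : d.1.stem.length = i := length_seg p hi
      have h1 := realizes_iff.1 hk d
      have h2 := realizes_iff.1 hk' d
      have h3 : rung I p x d.1.stem.length = rung I p x i := by rw [hd]
      have h4 : rung I p x' d.1.stem.length = rung I p x' i := by rw [hd]
      rw [← h3, ← h4]
      change HasCommonCoeff I p x x' (pathClass I d.1.arrow.toPath • _)
        (pathClass I d.1.arrow.toPath • _)
      rw [h1, h2]
      exact .sum _ fun v _ => .smul _ (.rung _)
    · have hv : ∀ j, i + 1 ≤ j → j ≤ p.length → vtx p j ≠ t := by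
        intro j hij hj hjt
        obtain ⟨v, hv, hl⟩ := exists_isRightSubpath_of_vtx_eq hj hjt
        exact hex ⟨v, hv, by rw [length_seg p hi]; omega⟩
      rw [h.eq_zero_of_forall_vtx_ne
          (h.step i hi _ (pathClass_mem_arrowRadical (p := β.toPath) le_rfl))
          (vertexClass_smul_pathClass_smul _ _) hv,
        h'.eq_zero_of_forall_vtx_ne
          (h'.step i hi _ (pathClass_mem_arrowRadical (p := β.toPath) le_rfl))
          (vertexClass_smul_pathClass_smul _ _) hv]
      exact .zero
  · rw [pathClass_smul_eq_zero_of_ne _ (vertexClass_smul_rung i) hm,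
      pathClass_smul_eq_zero_of_ne _ (vertexClass_smul_rung i) hm]
    exact .zero

theorem hasCommonCoeff_smul (h : IsLadder I p x) (h' : IsLadder I p x')
    (hk : Realizes I k x) (hk' : Realizes I k x') (r : PathAlgebra K V ⧸ I) :
    HasCommonCoeff I p x x' (r • x) (r • x') := by
  refine quotient_induction (P := fun r => HasCommonCoeff I p x x' (r • x) (r • x')) ?_ ?_ ?_ ?_ r
  · rw [zero_smul, zero_smul]
    exact .zero
  · intro s t hs ht
    rw [add_smul, add_smul]
    exact hs.add ht
  · intro c s hs
    rw [Algebra.smul_def, mul_smul, mul_smul]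
    exact hs.smul c
  · intro c d q
    by_cases hc : c = a
    · subst hc
      induction q with
      | nil =>
        rw [h.vertex, h'.vertex]
        have := HasCommonCoeff.rung (I := I) (p := p) (x := x) (x' := x') 0
        rwa [rung_zero h.vertex, rung_zero h'.vertex] at this
      | cons q β ih =>
        obtain ⟨c, hz, hz'⟩ := ih
        rw [pathClass_cons, mul_smul, mul_smul, hz, hz', Finset.smul_sum, Finset.smul_sum]
        refine .sum _ fun j hj => ?_
        rw [algebraMap_smul_comm, algebraMap_smul_comm]
        exact (hasCommonCoeff_arrow_smul_rung h h' hk hk' β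
          (by rw [Finset.mem_range] at hj; omega)).smul _
    · rw [pathClass_smul_eq_zero_of_ne q h.vertex hc, pathClass_smul_eq_zero_of_ne q h'.vertex hc]
      exact .zero

theorem HasCommonCoeff.eq_zero (hI : IsAdmissible I) (h : IsLadder I p x) {z' : U'}
    (hz : HasCommonCoeff I p x x' 0 z') : z' = 0 := by
  obtain ⟨c, hc, rfl⟩ := hz
  have := h.eq_zero_of_sum_eq_zero hI _ Function.injective_id
    (fun j hj => by rw [Finset.mem_range] at hj; exact Nat.lt_succ_iff.1 hj) hc.symm
  exact Finset.sum_eq_zero fun j hj => by rw [this j hj, map_zero, zero_smul]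

/-- The isomorphism type of a uniserial module is determined by a point of the variety. -/
theorem nonempty_linearEquiv_of_realizes (hI : IsAdmissible I) (h : IsLadder I p x)
    (h' : IsLadder I p x') (hk : Realizes I k x) (hk' : Realizes I k x') :
    Nonempty (U ≃ₗ[PathAlgebra K V ⧸ I] U') := by
  refine nonempty_linearEquiv_of_forall_smul_eq_zero_iff h.span_eq_top h'.span_eq_top fun r =>
    ⟨fun h0 => ?_, fun h0 => ?_⟩
  · have := hasCommonCoeff_smul h h' hk hk' r
    rw [h0] at this
    exact this.eq_zero hI h
  · have := hasCommonCoeff_smul h' h hk' hk r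
    rw [h0] at this
    exact this.eq_zero hI h'

end Isomorphism

/-! ### Slack halyards -/

/-- A one-variable polynomial annihilates the coordinate function if and only if it vanishes at all
values of that coordinate on `V_p`. A nonzero such polynomial exists precisely for a finite set of
values. -/
theorem transcendental_coordVar_iff {d : Detour p} {i : DetourIndex d} :
    Transcendental K (coordVar I p d i) ↔
      ((fun k : DetourVar p → K => k ⟨d, i⟩) '' uniserialVariety I p).Infinite := by
  have haeval (q : Polynomial K) : Polynomial.aeval (coordVar I p d i) q = 0 ↔
      ∀ k ∈ uniserialVariety I p, q.eval (k ⟨d, i⟩) = 0 := by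
    have h1 : Polynomial.aeval (coordVar I p d i) q = Ideal.Quotient.mkₐ K
        (MvPolynomial.vanishingIdeal K (uniserialVariety I p))
          (Polynomial.aeval (MvPolynomial.X ⟨d, i⟩) q) := by
      rw [← Polynomial.aeval_algHom_apply]
      rfl
    rw [h1, Ideal.Quotient.mkₐ_eq_mk, Ideal.Quotient.eq_zero_iff_mem,
      MvPolynomial.mem_vanishingIdeal_iff]
    refine forall₂_congr fun k _ => ?_
    rw [← Polynomial.aeval_algHom_apply, MvPolynomial.aeval_X, Polynomial.coe_aeval_eq_eval]
  rw [transcendental_iff]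
  constructor
  · intro ht hfin
    have := ht (∏ c ∈ hfin.toFinset, (Polynomial.X - Polynomial.C c)) ((haeval _).2 fun k hk => by
      rw [Polynomial.eval_prod]
      refine Finset.prod_eq_zero (i := k ⟨d, i⟩) (hfin.mem_toFinset.2 ⟨k, hk, rfl⟩) ?_
      rw [Polynomial.eval_sub, Polynomial.eval_X, Polynomial.eval_C, sub_self])
    exact (Polynomial.monic_prod_X_sub_C id hfin.toFinset).ne_zero this
  · classical
    intro hinf q hq
    by_contra hq0
    refine hinf ((q.roots.toFinset.finite_toSet).subset ?_)
    rintro _ ⟨k, hk, rfl⟩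
    rw [Finset.mem_coe, Multiset.mem_toFinset, Polynomial.mem_roots hq0]
    exact (haeval q).1 hq k hk

theorem coordVar_eq_zero_iff {d : Detour p} {i : DetourIndex d} :
    coordVar I p d i = 0 ↔ ∀ k ∈ uniserialVariety I p, k ⟨d, i⟩ = 0 := by
  rw [coordVar, Ideal.Quotient.eq_zero_iff_mem, MvPolynomial.mem_vanishingIdeal_iff]
  refine forall₂_congr fun k _ => ?_
  rw [MvPolynomial.aeval_X]

theorem isSlackHalyard_iff {d : Detour p} : IsSlackHalyard I p d ↔ ∃ i : DetourIndex d,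
    ((fun k : DetourVar p → K => k ⟨d, i⟩) '' uniserialVariety I p).Infinite := by
  simp only [← transcendental_coordVar_iff]
  refine ⟨fun h => h.2, fun ⟨i, hi⟩ => ⟨⟨i, fun h0 => ?_⟩, i, hi⟩⟩
  rw [h0] at hi
  exact hi isAlgebraic_zero

end Coordinates

/-! ### Paths starting at a vertex with a loop -/

section Loops

section Quivers

variable {V : Type v} [Quiver.{w} V]

theorem length_loopPow {e : V} (γ : e ⟶ e) (m : ℕ) : (loopPow γ m).length = m := by
  induction m with
  | zero => rfl
  | succ m ih => rw [loopPow, Quiver.Path.length_cons, ih]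

theorem vtx_loopPow {e : V} (γ : e ⟶ e) (m i : ℕ) : vtx (loopPow γ m) i = e := by
  induction m with
  | zero => rfl
  | succ m ih =>
    rw [vtx, loopPow, initPath]
    split_ifs
    · exact ih
    · rfl

theorem vtx_add_of_seg_eq_comp {a b : V} {p : Quiver.Path a b} {i j : ℕ}
    {q : Quiver.Path (vtx p i) (vtx p j)} (h : seg p j = (seg p i).comp q) (hi : i ≤ p.length)
    {n : ℕ} (hn : n ≤ q.length) : vtx p (i + n) = vtx q n := by
  obtain ⟨r, hr⟩ := exists_comp_seg p j
  have h1 : initPath (((seg p i).comp q).comp r) (i + n) = ⟨vtx q n, (seg p i).comp (seg q n)⟩ := by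
    rw [initPath_comp_of_le _ _ (by rw [Quiver.Path.length_comp, length_seg p hi]; omega)]
    have := initPath_comp_add (seg p i) q n
    rwa [length_seg p hi] at this
  rw [← h, ← hr] at h1
  rw [vtx, h1]

theorem mem_vertices_iff {a b e : V} {p : Quiver.Path a b} :
    e ∈ p.vertices ↔ ∃ i ≤ p.length, vtx p i = e := by
  rw [vertices_eq_ofFn, List.mem_ofFn]
  exact ⟨fun ⟨i, hi⟩ => ⟨i, by omega, hi⟩, fun ⟨i, hi, he⟩ => ⟨⟨i, by omega⟩, he⟩⟩

theorem exists_vtx_eq_of_mem_tail_vertices {a b e : V} {p : Quiver.Path a b}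
    (h : e ∈ p.vertices.tail) : ∃ i, 1 ≤ i ∧ i ≤ p.length ∧ vtx p i = e := by
  rw [vertices_eq_ofFn, List.ofFn_succ, List.tail_cons, List.mem_ofFn] at h
  obtain ⟨i, hi⟩ := h
  exact ⟨i + 1, by omega, by omega, hi⟩

/-- The vertices of `p` which agree with its initial vertex are precisely those in positions
`0, …, μ`. -/
def ReturnsUpTo {a b : V} (p : Quiver.Path a b) (μ : ℕ) : Prop :=
  μ ≤ p.length ∧ ∀ i ≤ p.length, vtx p i = a ↔ i ≤ μ

end Quivers

variable {K : Type u} {V : Type v} [Field K] [Quiver.{w} V] [Fintype V]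
  {I : Ideal (PathAlgebra K V)} [I.IsTwoSided] {a b : V} {p : Quiver.Path a b}

/-- Under condition (N), a nontrivial segment of a mast with the same ends as an arrow satisfies
that the second vertex is the target of the arrow, or the last but one is its source. -/
theorem ConditionN.vtx_succ_eq_or (hN : ConditionN I) (hI : IsAdmissible I) (hm : IsMast I p)
    {i j : ℕ} (hij : i < j) (hj : j ≤ p.length) (β : vtx p i ⟶ vtx p j) :
    vtx p (i + 1) = vtx p j ∨ vtx p (j - 1) = vtx p i := by
  obtain ⟨q, hq, hs⟩ := exists_seg_eq_comp p hij.le hj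
  rcases hN _ _ β q (by omega) (hm.of_seg_eq_comp hI hs) with ⟨c, hc⟩ | ⟨c, hc⟩
  · left
    rw [vtx_add_of_seg_eq_comp hs (by omega) (n := 1) (by omega)]
    have := initPath_comp_length β.toPath c
    rw [Quiver.Path.length_toPath, ← hc] at this
    rw [vtx, this]
  · right
    have hl := congrArg Quiver.Path.length hc
    rw [Quiver.Path.length_comp, Quiver.Path.length_toPath] at hl
    have h1 : j - 1 = i + c.length := by omega
    rw [h1, vtx_add_of_seg_eq_comp hs (by omega) (n := c.length) (by omega)]
    have := initPath_comp_length c β.toPath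
    rw [← hc] at this
    rw [vtx, this]

/-- The loop is parallel to any segment between two occurrences of `a`, so by (N) the segment starts
or ends with it. Either way one end moves inward to another occurrence of `a`, and induction fills
the whole gap. -/
theorem ConditionN.exists_returnsUpTo (hN : ConditionN I) (hI : IsAdmissible I) (hm : IsMast I p)
    (γ : a ⟶ a) : ∃ μ, ReturnsUpTo p μ := by
  classical
  have key (n : ℕ) : ∀ i j, j = i + n → j ≤ p.length → vtx p i = a → vtx p j = a →
      ∀ k, i ≤ k → k ≤ j → vtx p k = a := by
    induction n with
    | zero =>
      intro i j hij _ hi _ k h1 h2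
      obtain rfl : k = i := by omega
      exact hi
    | succ n ih =>
      intro i j hij hj hi hja k h1 h2
      have hβ : Nonempty (vtx p i ⟶ vtx p j) := by
        rw [hi, hja]
        exact ⟨γ⟩
      obtain ⟨β⟩ := hβ
      rcases hN.vtx_succ_eq_or hI hm (by omega) hj β with h | h
      · rcases h1.eq_or_lt with rfl | h1'
        · exact hi
        · exact ih (i + 1) j (by omega) hj (h.trans hja) hja k h1' h2
      · rcases h2.eq_or_lt with rfl | h2'
        · exact hja
        · exact ih i (j - 1) (by omega) (by omega) hi (h.trans hi) k h1 (by omega)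
  -- `μ` is the position of the last occurrence of `a`.
  refine ⟨Nat.findGreatest (fun i => vtx p i = a) p.length, Nat.findGreatest_le _, fun i hi =>
    ⟨fun h => Nat.le_findGreatest hi h, fun h => ?_⟩⟩
  exact key (Nat.findGreatest (fun i => vtx p i = a) p.length) 0 _ (by omega)
    (Nat.findGreatest_le _) (vtx_zero p)
    (Nat.findGreatest_spec (P := fun i => vtx p i = a) (Nat.zero_le _) (vtx_zero p)) i
    (Nat.zero_le _) h

/-- Compare the arrow with the segment from position `μ - 1` to `j`. It cannot be the first arrow,
as position `μ` is still at `a` and `j` is not; if it is the last one, then `j - 1` belongs to the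
run. -/
theorem ConditionN.eq_succ_of_arrow (hN : ConditionN I) (hI : IsAdmissible I) (hm : IsMast I p)
    {μ : ℕ} (hμ : ReturnsUpTo p μ) (h1 : 1 ≤ μ) {j : ℕ} (hj : μ < j) (hjl : j ≤ p.length)
    (β : a ⟶ vtx p j) : j = μ + 1 := by
  have ha := (hμ.2 (μ - 1) (by omega)).2 (by omega)
  have hβ : Nonempty (vtx p (μ - 1) ⟶ vtx p j) := by
    rw [ha]
    exact ⟨β⟩
  obtain ⟨β'⟩ := hβ
  rcases hN.vtx_succ_eq_or hI hm (by omega) hjl β' with h | h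
  · rw [Nat.sub_add_cancel h1, (hμ.2 μ hμ.1).2 le_rfl] at h
    have := (hμ.2 j hjl).1 h.symm
    omega
  · have := (hμ.2 (j - 1) (by omega)).1 (h.trans ha)
    omega

/-- An arrow with the same ends as the `i`-th arrow of a mast is equal to that arrow. -/
theorem ConditionN.initPath_succ (hN : ConditionN I) (hI : IsAdmissible I) (hm : IsMast I p)
    {i : ℕ} (hi : i < p.length) {c d : V} (β : c ⟶ d) {q : Quiver.Path a c}
    (hq : initPath p i = ⟨c, q⟩) (hd : vtx p (i + 1) = d) :
    initPath p (i + 1) = ⟨d, q.cons β⟩ := by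
  subst hd
  rw [initPath_eq] at hq
  have claim : ∀ (s : Σ c : V, Quiver.Path a c) (β' : s.1 ⟶ vtx p (i + 1)),
      (⟨vtx p i, seg p i⟩ : Σ c : V, Quiver.Path a c) = s →
        initPath p (i + 1) = ⟨vtx p (i + 1), s.2.cons β'⟩ := by
    rintro _ β' rfl
    rw [initPath_eq, hN.seg_succ_eq_cons hI hm hi β']
  exact claim ⟨c, q⟩ β hq

theorem ConditionN.arrow_smul_rung (hN : ConditionN I) (hI : IsAdmissible I) (hm : IsMast I p)
    {U : Type*} [AddCommGroup U] [Module (PathAlgebra K V ⧸ I) U] {x : U}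
    {i : ℕ} (hi : i < p.length) {c d : V} (β : c ⟶ d) (hc : vtx p i = c)
    (hd : vtx p (i + 1) = d) : pathClass I β.toPath • rung I p x i = rung I p x (i + 1) := by
  subst hc hd
  exact (rung_succ β (hN.seg_succ_eq_cons hI hm hi β) hi).symm

variable {μ : ℕ} (hN : ConditionN I) (hI : IsAdmissible I) (hm : IsMast I p)
  (hμ : ReturnsUpTo p μ)
include hN hI hm hμ

theorem ConditionN.initPath_eq_loopPow (γ : a ⟶ a) {i : ℕ} (hi : i ≤ μ) :
    initPath p i = ⟨a, loopPow γ i⟩ := by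
  have hμl := hμ.1
  induction i with
  | zero => exact initPath_zero p
  | succ i ih =>
    exact hN.initPath_succ hI hm (by omega) γ (ih (by omega)) ((hμ.2 _ (by omega)).2 hi)

/-- A detour whose stem is shorter than `γ ^ μ` ends in the vertex following `γ ^ μ`. -/
theorem ConditionN.detour_of_length_lt {d : Detour p} (hd : d.1.stem.length < μ) :
    μ < p.length ∧ d.1.mid = a ∧ d.1.tgt = vtx p (μ + 1) := by
  obtain ⟨⟨β, q⟩, hq, hqβ, v, hv, hvl⟩ := d
  rename_i c e
  dsimp only at hd hq hqβ v hv hvl ⊢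
  have hμl := hμ.1
  have hc : c = a := by
    rw [← hq.vtx_eq]
    exact (hμ.2 _ hq.length_le).2 hd.le
  have hv' := hv.vtx_eq
  have hvlen := hv.length_le
  have hlt : μ < v.length := by
    -- If the longer subpath also ended within the run, `β` would be a loop at `a`, so by (N) the
    -- next arrow of `p`, and not a detour.
    by_contra hle
    apply hqβ
    have he : e = a := by
      rw [← hv']
      exact (hμ.2 _ hvlen).2 (by omega)
    have h1 := hN.initPath_succ hI hm (i := q.length) (by omega) β hq.initPath_eq
      (by rw [he]; exact (hμ.2 _ (by omega)).2 (by omega))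
    obtain ⟨r, hr⟩ := exists_comp_seg p (q.length + 1)
    have claim : ∀ s : Σ c : V, Quiver.Path a c, initPath p (q.length + 1) = s →
        IsRightSubpath s.2 p := by
      rintro _ rfl
      exact ⟨r, hr⟩
    exact claim _ h1
  have hβ : Nonempty (a ⟶ vtx p v.length) := by
    rw [hv', ← hc]
    exact ⟨β⟩
  obtain ⟨β'⟩ := hβ
  have hj := hN.eq_succ_of_arrow hI hm hμ (by omega) hlt hvlen β'
  exact ⟨by omega, hc, by rw [← hj]; exact hv'.symm⟩

end Loops

/-- A detour is determined by the length of its stem and its arrow. -/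
theorem finite_detour {V : Type v} [Fintype V] [Quiver.{w} V] {a b : V} {p : Quiver.Path a b}
    [∀ a b : V, Finite (a ⟶ b)] : Finite (Detour p) := by
  have hfin : (Set.range fun t : Σ i : Fin (p.length + 1), Σ e : V, (vtx p i ⟶ e) =>
      (⟨t.2.2, seg p t.1⟩ : ArrowAfterPath a)).Finite := Set.finite_range _
  suffices h : {d : ArrowAfterPath a | IsDetour p d}.Finite from h.to_subtype
  refine hfin.subset fun d hd => ?_
  have hl := hd.1.length_le
  have claim : ∀ (s : Σ c : V, Quiver.Path a c) {e : V} (β : s.1 ⟶ e),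
      initPath p d.stem.length = s → ∃ t : Σ i : Fin (p.length + 1), Σ e : V, (vtx p i ⟶ e),
        (⟨t.2.2, seg p t.1⟩ : ArrowAfterPath a) = ⟨β, s.2⟩ := by
    rintro _ e β rfl
    exact ⟨⟨⟨d.stem.length, by omega⟩, e, β⟩, rfl⟩
  exact claim ⟨_, d.stem⟩ d.arrow hd.1.initPath_eq

/-! ### The loop form in terms of the initial run and the short detours -/

section LoopForm

variable {K : Type u} {V : Type v} [Field K] [Quiver.{w} V] [Fintype V]
  {I : Ideal (PathAlgebra K V)} [I.IsTwoSided] {a b : V} {p : Quiver.Path a b}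

theorem ConditionN.hasLoopForm (hN : ConditionN I) (hI : IsAdmissible I) (hm : IsMast I p)
    (γ : a ⟶ a) {μ : ℕ} (hμ : ReturnsUpTo p μ)
    (hs : ∀ d : Detour p, IsSlackHalyard I p d → d.1.stem.length < μ) : HasLoopForm I p := by
  have hμl := hμ.1
  have hγ : initPath p μ = ⟨a, loopPow γ μ⟩ := hN.initPath_eq_loopPow hI hm hμ γ le_rfl
  refine ⟨γ, μ, p.length - μ, by omega, ?_⟩
  rcases hμl.eq_or_lt with hl | hl
  · left
    refine ⟨by omega, ?_, fun d hd => ?_⟩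
    · rw [initPath_of_le p hl.ge] at hγ
      exact congrArg (fun s : Σ c : V, Quiver.Path a c => (⟨a, s.1, s.2⟩ : QuiverPath V)) hγ
    · have := (hN.detour_of_length_lt hI hm hμ (hs d hd)).1
      omega
  · right
    obtain ⟨q, hq⟩ : IsRightSubpath (loopPow γ μ) p := by
      have claim : ∀ s : Σ c : V, Quiver.Path a c, initPath p μ = s → IsRightSubpath s.2 p := by
        rintro _ rfl
        exact isRightSubpath_seg p μ
      exact claim _ hγ
    have hql := congrArg Quiver.Path.length hq
    rw [Quiver.Path.length_comp, length_loopPow] at hql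
    obtain ⟨e₁, α, r, hr, rfl⟩ := q.eq_toPath_comp_of_length_eq_succ (n := p.length - μ - 1)
      (by omega)
    have hq' : p = ((loopPow γ μ).comp α.toPath).comp r := by
      rw [hq, Quiver.Path.comp_assoc]
    have hvr (i : ℕ) : vtx p (μ + 1 + i) = vtx r i := by
      have := initPath_comp_add ((loopPow γ μ).comp α.toPath) r i
      rw [← hq', Quiver.Path.length_comp, length_loopPow, Quiver.Path.length_toPath] at this
      rw [vtx, this]
    have he₁ : vtx p (μ + 1) = e₁ := by
      rw [← Nat.add_zero (μ + 1), hvr, vtx_zero]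
    refine ⟨e₁, α, r, by omega, hq, fun hmem => ?_, fun h1 h2 hmem => ?_, fun d hd => ?_⟩
    · obtain ⟨i, hi, hia⟩ := mem_vertices_iff.1 hmem
      have := (hμ.2 (μ + 1 + i) (by omega)).1 ((hvr i).trans hia)
      omega
    · obtain ⟨i, hi1, hi, hia⟩ := exists_vtx_eq_of_mem_tail_vertices hmem
      -- A second visit to `e₁` would make `α` an arrow from `a` to a vertex beyond position `μ +
      -- 1`, against `eq_succ_of_arrow`.
      have hβ : Nonempty (a ⟶ vtx p (μ + 1 + i)) := by
        rw [hvr, hia]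
        exact ⟨α⟩
      obtain ⟨β⟩ := hβ
      have := hN.eq_succ_of_arrow hI hm hμ h1 (by omega) (by omega) β
      omega
    · have hlt := hs d hd
      obtain ⟨-, hmid, htgt⟩ := hN.detour_of_length_lt hI hm hμ hlt
      refine ⟨d.1.stem.length, hlt, ?_⟩
      have h1 := d.2.1.initPath_eq
      rw [hN.initPath_eq_loopPow hI hm hμ γ hlt.le] at h1
      have h2 := hN.initPath_succ hI hm hl α hγ he₁
      obtain ⟨⟨β, q⟩, hdet⟩ := d
      rename_i c e
      change c = a at hmid
      change e = _ at htgt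
      subst hmid
      obtain rfl : e = e₁ := htgt.trans he₁
      -- Both `α` and the arrow of the detour extend `γ ^ μ` to the same right subpath of `p`, so
      -- they coincide.
      have h3 := hN.initPath_succ hI hm hl β hγ he₁
      rw [h2] at h3
      simp only [Sigma.mk.injEq, heq_eq_eq, Quiver.Path.cons.injEq, true_and] at h1 h3
      obtain rfl := h3
      change ArrowAfterPath.mk _ q = ArrowAfterPath.mk _ (loopPow γ q.length)
      rw [h1]

/-- The converse and the uniqueness statement need only these two features of the loop form. -/
theorem HasLoopForm.exists_returnsUpTo (h : HasLoopForm I p) : ∃ μ, ReturnsUpTo p μ ∧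
    ∀ d : Detour p, IsSlackHalyard I p d → d.1.stem.length < μ := by
  obtain ⟨γ, μ, ν, hl, ⟨rfl, hp, hs⟩ | ⟨e₁, α, r, hr, hp, hr', -, hs⟩⟩ := h
  · refine ⟨μ, ⟨by omega, fun i hi => ⟨fun _ => by omega, fun _ => ?_⟩⟩,
      fun d hd => absurd hd (hs d)⟩
    obtain rfl : b = a := congrArg QuiverPath.tgt hp
    simp only [QuiverPath.mk.injEq, heq_eq_eq, true_and] at hp
    rw [hp, vtx_loopPow]
  · refine ⟨μ, ⟨by omega, fun i hi => ⟨fun hia => ?_, fun hiμ => ?_⟩⟩, fun d hd => ?_⟩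
    · by_contra hlt
      obtain ⟨j, rfl⟩ := Nat.exists_eq_add_of_le (show μ + 1 ≤ i by omega)
      rw [← Quiver.Path.comp_assoc] at hp
      have := initPath_comp_add ((loopPow γ μ).comp α.toPath) r j
      rw [← hp, Quiver.Path.length_comp, length_loopPow, Quiver.Path.length_toPath] at this
      rw [vtx, this] at hia
      exact hr' (mem_vertices_iff.2 ⟨j, by omega, hia⟩)
    · rw [vtx, hp, initPath_comp_of_le _ _ (by rwa [length_loopPow])]
      exact vtx_loopPow γ μ i
    · obtain ⟨i, hi, hd'⟩ := hs d hd
      have : d.1.stem.length = i := by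
        rw [hd']
        exact length_loopPow γ i
      omega

end LoopForm

/-! ### Change of the top element -/

theorem nonempty_hom_of_eq {V : Type v} [Quiver.{w} V] {c c' d d' : V} (hc : c = c') (hd : d = d')
    (α : c ⟶ d) : Nonempty (c' ⟶ d') := by
  subst hc hd
  exact ⟨α⟩

section TopChange

variable {K : Type u} {V : Type v} [Field K] [Quiver.{w} V] [Fintype V]
  {I : Ideal (PathAlgebra K V)} [I.IsTwoSided] {a b : V} {p : Quiver.Path a b}
  {U : Type*} [AddCommGroup U] [Module (PathAlgebra K V ⧸ I) U] {x x' : U} {μ : ℕ}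

theorem vertexClass_smul_of_eq {e e' : V} (h : e = e') {y : U} (hy : vertexClass I e • y = y) :
    vertexClass I e' • y = y := h ▸ hy

/-- Write `x' = c x + w` with `w` a radical multiple of `x` at the vertex `a`. The run kills `w`,
because its image lies at `a` strictly beyond position `μ`; longer right subpaths factor through the
run. -/
theorem IsLadder.exists_rung_eq_smul (h : IsLadder I p x) (h' : IsLadder I p x')
    (hμ : ReturnsUpTo p μ) : ∃ c : K, ∀ n, μ ≤ n →
      rung I p x' n = algebraMap K (PathAlgebra K V ⧸ I) c • rung I p x n := by
  have hx' : x' ∈ Submodule.span (PathAlgebra K V ⧸ I) {x} := h.span_eq_top ▸ Submodule.mem_top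
  obtain ⟨s, hs⟩ := Submodule.mem_span_singleton.1 hx'
  obtain ⟨c, r, hr, hc⟩ := exists_smul_eq_of_vertexClass_smul h.vertex s
  refine ⟨c, fun n hn => ?_⟩
  by_cases hnl : n ≤ p.length
  swap
  · rw [rung_of_lt (by omega), rung_of_lt (by omega), smul_zero]
  rw [hs] at hc
  have hw : r • x = x' - algebraMap K (PathAlgebra K V ⧸ I) c • x := (sub_eq_of_eq_add' hc).symm
  have hwv : vertexClass I a • r • x = r • x := by
    rw [hw, smul_sub, h'.vertex, algebraMap_smul_comm, h.vertex]
  have hw1 : r • x ∈ rungSpan I p x (0 + 1) :=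
    h.smul_mem (i := 0) (h.rungSpan_zero ▸ Submodule.mem_top) hr
  have h0 : pathClass I (seg p μ) • r • x = 0 := by
    refine h.eq_zero_of_forall_vtx_ne (h.seg_smul_mem hw1 hμ.1) (e := a) ?_ fun j hj hjl hja => ?_
    · exact vertexClass_smul_of_eq ((hμ.2 μ hμ.1).2 le_rfl) (vertexClass_smul_pathClass_smul _ _)
    · have := (hμ.2 j hjl).1 hja
      omega
  obtain ⟨q, -, hq⟩ := exists_seg_eq_comp p hn hnl
  rw [rung_of_le hnl, rung_of_le hnl, hc, smul_add, algebraMap_smul_comm, hq, pathClass_comp,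
    mul_smul _ _ (r • x), h0, smul_zero, add_zero]

/-- The coordinates of detours whose stem is not shorter than the initial power of the loop do not
depend on the choice of the top element. -/
theorem Realizes.eq_of_le_length (hI : IsAdmissible I) (h : IsLadder I p x)
    (h' : IsLadder I p x') (hμ : ReturnsUpTo p μ) {k k' : DetourVar p → K} (hk : Realizes I k x)
    (hk' : Realizes I k' x') {d : Detour p} (hd : μ ≤ d.1.stem.length) (i : DetourIndex d) :
    k ⟨d, i⟩ = k' ⟨d, i⟩ := by
  obtain ⟨c, hc⟩ := h'.exists_rung_eq_smul h hμ
  have hc0 : c ≠ 0 := by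
    rintro rfl
    apply rung_ne_zero (i := p.length) h.ne_zero le_rfl
    rw [hc _ hμ.1, map_zero, zero_smul]
  have h1 := realizes_iff.1 hk d
  have h2 := realizes_iff.1 hk' d
  -- Both sides of the detour relation involve only rungs from `μ` on, which all scale by the same
  -- `c`; comparing coefficients cancels it.
  rw [hc _ hd, algebraMap_smul_comm, h2, Finset.smul_sum, ← sub_eq_zero,
    ← Finset.sum_sub_distrib] at h1
  have h3 (j : DetourIndex d) : algebraMap K (PathAlgebra K V ⧸ I) c •
      algebraMap K (PathAlgebra K V ⧸ I) (k' ⟨d, j⟩) • rung I p x' j.1.length -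
        algebraMap K (PathAlgebra K V ⧸ I) (k ⟨d, j⟩) • rung I p x j.1.length =
      algebraMap K (PathAlgebra K V ⧸ I) (c * (k' ⟨d, j⟩ - k ⟨d, j⟩)) •
        rung I p x' j.1.length := by
    have hj := j.2.2
    rw [hc _ (by omega), ← mul_smul, ← mul_smul, ← sub_smul, ← map_mul, ← map_mul, ← map_sub]
    congr 2
    ring
  simp only [h3] at h1
  have h4 := h'.eq_zero_of_sum_eq_zero hI _ DetourIndex.length_injective
    (fun j _ => j.2.1.length_le) h1 i (Finset.mem_univ _)
  exact (sub_eq_zero.1 ((mul_eq_zero.1 h4).resolve_left hc0)).symm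

theorem Realizes.eq_of_linearEquiv (hI : IsAdmissible I) {U' : Type*} [AddCommGroup U']
    [Module (PathAlgebra K V ⧸ I) U'] {y : U'} (f : U ≃ₗ[PathAlgebra K V ⧸ I] U')
    (h : IsLadder I p x) (h' : IsLadder I p y) (hμ : ReturnsUpTo p μ) {k k' : DetourVar p → K}
    (hk : Realizes I k x) (hk' : Realizes I k' y) {d : Detour p} (hd : μ ≤ d.1.stem.length)
    (i : DetourIndex d) : k ⟨d, i⟩ = k' ⟨d, i⟩ := by
  refine Realizes.eq_of_le_length hI h (x' := f.symm y) ?_ hμ hk (fun d => ?_) hd i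
  · refine (h.isMastOf hI).isLadder hI ?_ ?_
    · rw [← map_smul, h'.vertex]
    · rw [← map_smul, Ne, f.symm.map_eq_zero_iff]
      exact h'.ne_zero
  · rw [← map_smul, hk' d, map_sum]
    simp only [map_smul]

/-! ### Removing the short coordinates by changing the top element -/

section Normalization

variable (hN : ConditionN I) (hI : IsAdmissible I) (hm : IsMast I p) (hμ : ReturnsUpTo p μ)
include hN hI hm hμ

theorem ConditionN.seg_smul_rung {i j : ℕ} (hij : i + j ≤ μ) :
    pathClass I (seg p i) • rung I p x j = rung I p x (i + j) := by
  have hμl := hμ.1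
  induction i with
  | zero =>
    have h1 := vertexClass_smul_rung (I := I) (p := p) (x := x) j
    rw [(hμ.2 j (by omega)).2 (by omega)] at h1
    have claim : ∀ s : Σ c : V, Quiver.Path a c, s = ⟨a, .nil⟩ →
        pathClass I s.2 = vertexClass I a := by
      rintro _ rfl
      rfl
    rw [zero_add]
    conv_rhs => rw [← h1, ← claim _ (initPath_zero p)]
    rfl
  | succ i ih =>
    obtain ⟨β, hβ⟩ := exists_seg_succ p (i := i) (by omega)
    have hv {n : ℕ} (hn : n ≤ μ) : vtx p n = a := (hμ.2 n (by omega)).2 hn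
    rw [hβ, pathClass_cons, mul_smul, ih (by omega), hN.arrow_smul_rung hI hm (by omega) β
      ((hv (by omega)).trans (hv (by omega)).symm) ((hv (by omega)).trans (hv (by omega)).symm)]
    congr 1
    omega

-- The product lies at the vertex `a`, but in the span of rungs beyond the last occurrence of `a`.
omit hN hI hm in
theorem ReturnsUpTo.seg_smul_rung_eq_zero (h : IsLadder I p x) {i j : ℕ} (hi : i ≤ μ)
    (hij : μ < i + j) : pathClass I (seg p i) • rung I p x j = 0 := by
  have hμl := hμ.1
  refine h.eq_zero_of_forall_vtx_ne (h.seg_smul_mem (rung_mem j) (by omega)) (e := a) ?_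
    fun n hn hnl hna => ?_
  · exact vertexClass_smul_of_eq ((hμ.2 i (by omega)).2 hi) (vertexClass_smul_pathClass_smul _ _)
  · have := (hμ.2 n hnl).1 hna
    omega

/-- The elements `α γ ^ i x` are killed for `i = μ - 1, μ - 2, …` in turn. If `α γ ^ (μ - m - 1) x =
c α γ ^ μ x`, replace `x` by `x - c γ ^ (m + 1) x`. This cancels the term at `i = μ - m - 1` and
leaves larger `i` alone, since `γ ^ i γ ^ (m + 1) x = 0` there. -/
theorem ConditionN.exists_isLadder_arrow_smul_eq_zero (h : IsLadder I p x) (hl : μ < p.length)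
    {α : vtx p μ ⟶ vtx p (μ + 1)} (hα : seg p (μ + 1) = (seg p μ).cons α) {m : ℕ} (hmμ : m ≤ μ) :
    ∃ x : U, IsLadder I p x ∧
      ∀ i < μ, μ ≤ i + m → pathClass I α.toPath • rung I p x i = 0 := by
  have ha {i : ℕ} (hi : i ≤ μ) : vtx p i = a := (hμ.2 i (by omega)).2 hi
  induction m with
  | zero => exact ⟨x, h, fun i hi hi' => absurd hi (by omega)⟩
  | succ m ih =>
    obtain ⟨x, h, hx⟩ := ih (by omega)
    -- Only one coefficient can occur: among the rungs from `μ - m` on, the target of `α` appears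
    -- solely at position `μ + 1`.
    obtain ⟨c, hc⟩ := h.exists_eq_smul_rung (i := μ - m) (m := μ + 1)
      (z := pathClass I α.toPath • rung I p x (μ - m - 1)) (e := vtx p (μ + 1))
      (rungSpan_antitone (show μ - m ≤ μ - m - 1 + 1 by omega)
        (h.smul_mem (rung_mem _) (pathClass_mem_arrowRadical le_rfl)))
      (vertexClass_smul_pathClass_smul _ _) fun j hj hjl hjv => by
        by_cases hjμ : j ≤ μ
        · have := (hμ.2 (μ + 1) hl).1 (hjv.symm.trans (ha hjμ))
          omega
        · obtain ⟨β⟩ : Nonempty (a ⟶ vtx p j) := nonempty_hom_of_eq (ha le_rfl) hjv.symm α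
          exact hN.eq_succ_of_arrow hI hm hμ (by omega) (by omega) hjl β
    have hr1 : rung I p x (m + 1) ∈ rungSpan I p x 1 := rungSpan_antitone (by omega) (rung_mem _)
    set y := x - algebraMap K (PathAlgebra K V ⧸ I) c • rung I p x (m + 1) with hy
    have hladder : IsLadder I p y := by
      refine h.of_notMem hI ?_ fun hmem => ?_
      · rw [hy, smul_sub, h.vertex, algebraMap_smul_comm]
        congr 2
        exact vertexClass_smul_of_eq (ha hmμ) (vertexClass_smul_rung _)
      · apply rung_notMem_rungSpan_succ hI h.ne_zero (Nat.zero_le _)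
        rw [rung_zero h.vertex]
        have := add_mem hmem (Submodule.smul_mem _ (algebraMap K (PathAlgebra K V ⧸ I) c) hr1)
        rwa [hy, sub_add_cancel] at this
    refine ⟨y, hladder, fun i hi him => ?_⟩
    have hyi : rung I p y i = rung I p x i -
        algebraMap K (PathAlgebra K V ⧸ I) c • pathClass I (seg p i) • rung I p x (m + 1) := by
      rw [rung_of_le (by omega), hy, smul_sub, algebraMap_smul_comm, ← rung_of_le (by omega)]
    rw [hyi, smul_sub, algebraMap_smul_comm]
    by_cases hi' : μ ≤ i + m
    · rw [hx i hi hi', hμ.seg_smul_rung_eq_zero h hi.le (by omega), smul_zero, smul_zero, sub_zero]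
    · obtain rfl : i = μ - m - 1 := by omega
      rw [hc, hN.seg_smul_rung hI hm hμ (by omega), show μ - m - 1 + (m + 1) = μ by omega,
        ← rung_succ α hα hl, sub_self]

/-- There is a top element for which the coordinates of all detours with a short stem vanish. -/
theorem ConditionN.exists_normalized (h : IsLadder I p x) :
    ∃ x : U, IsLadder I p x ∧ ∃ k : DetourVar p → K, Realizes I k x ∧
      ∀ d : Detour p, d.1.stem.length < μ → ∀ i : DetourIndex d, k ⟨d, i⟩ = 0 := by
  by_cases hl : μ < p.length
  · obtain ⟨α, hα⟩ := exists_seg_succ p hl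
    obtain ⟨y, hy, hy0⟩ := hN.exists_isLadder_arrow_smul_eq_zero hI hm hμ h hl hα le_rfl
    obtain ⟨k, hk⟩ := hy.exists_realizes
    refine ⟨y, hy, k, hk, fun d hd i => ?_⟩
    -- By (N), the arrow of every short detour is `α`, which kills the rungs before `μ` of the new
    -- top element.
    have claim : ∀ {c t : V} (β : c ⟶ t), c = vtx p μ → t = vtx p (μ + 1) →
        pathClass I β.toPath = pathClass I α.toPath := by
      rintro _ _ β rfl rfl
      have := hN.seg_succ_eq_cons hI hm hl β
      rw [hα, Quiver.Path.cons.injEq] at this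
      rw [eq_of_heq this.2.2]
    obtain ⟨-, hmid, htgt⟩ := hN.detour_of_length_lt hI hm hμ hd
    have h1 := realizes_iff.1 hk d
    rw [claim d.1.arrow (hmid.trans ((hμ.2 μ hμ.1).2 le_rfl).symm) htgt, hy0 _ hd (by omega)] at h1
    exact hy.eq_zero_of_sum_eq_zero hI _ DetourIndex.length_injective
      (fun j _ => j.2.1.length_le) h1.symm i (Finset.mem_univ _)
  · obtain ⟨k, hk⟩ := h.exists_realizes
    exact ⟨x, h, k, hk, fun d hd => absurd (hN.detour_of_length_lt hI hm hμ hd).1 hl⟩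

/-- Uniserial modules are isomorphic if the coordinates of all detours with long stem agree. -/
theorem ConditionN.nonempty_linearEquiv {U' : Type*} [AddCommGroup U']
    [Module (PathAlgebra K V ⧸ I) U'] {y : U'} (h : IsLadder I p x) (h' : IsLadder I p y)
    {k k' : DetourVar p → K} (hk : Realizes I k x) (hk' : Realizes I k' y)
    (heq : ∀ d : Detour p, μ ≤ d.1.stem.length → ∀ i : DetourIndex d, k ⟨d, i⟩ = k' ⟨d, i⟩) :
    Nonempty (U ≃ₗ[PathAlgebra K V ⧸ I] U') := by
  obtain ⟨x₁, h₁, k₁, hk₁, hz₁⟩ := hN.exists_normalized hI hm hμ h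
  obtain ⟨y₁, h₁', k₁', hk₁', hz₁'⟩ := hN.exists_normalized hI hm hμ h'
  obtain rfl : k₁ = k₁' := by
    funext ⟨d, i⟩
    rcases Nat.lt_or_ge d.1.stem.length μ with hd | hd
    · rw [hz₁ d hd, hz₁' d hd]
    · rw [hk₁.eq_of_le_length hI h₁ h hμ hk hd, heq d hd,
        hk'.eq_of_le_length hI h' h₁' hμ hk₁' hd]
  exact nonempty_linearEquiv_of_realizes hI h₁ h₁' hk₁ hk₁'

end Normalization

end TopChange

/-! ### The main theorem -/

section Main

variable {K : Type u} {V : Type v} [Field K] [Quiver.{w} V] [Fintype V]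
  {I : Ideal (PathAlgebra K V)} [I.IsTwoSided] {a b : V} {p : Quiver.Path a b}

theorem mk_eq_mk_iff {R : Type u} [Ring R] {M N : ModuleCat.{v} R} :
    (Quotient.mk (CategoryTheory.isIsomorphicSetoid (ModuleCat.{v} R)) M =
      Quotient.mk (CategoryTheory.isIsomorphicSetoid (ModuleCat.{v} R)) N) ↔
      Nonempty (M ≃ₗ[R] N) :=
  ⟨fun h => (Quotient.exact h).map fun f => f.toLinearEquiv,
    fun h => Quotient.sound (h.map fun f => f.toModuleIso)⟩

/-! ### Isomorphism types and values of the long coordinates -/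

section Types

variable (hN : ConditionN I) (hI : IsAdmissible I) (hm : IsMast I p) {l : ℕ}
  {S : Fin (l + 1) → ModuleCat.{max u v w} (PathAlgebra K V ⧸ I)}
  (hS : ∀ i, IsSimpleModule (PathAlgebra K V ⧸ I) (S i)) (hp : PassesThrough I S p)
include hN hI hm hS hp

theorem ConditionN.exists_of_mem_uniserialTypes {c} (hc : c ∈ uniserialTypes S) :
    ∃ k ∈ uniserialVariety I p, ∃ U : ModuleCat.{max u v w} (PathAlgebra K V ⧸ I),
      Quotient.mk _ U = c ∧ ∃ x : U, IsLadder I p x ∧ Realizes I k x := by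
  obtain ⟨U, hU, rfl⟩ := hc
  obtain ⟨x, hx⟩ := ((isUniserialWithFactors_iff hN hI hS hp hm).1 hU).exists_isLadder hI
  obtain ⟨k, hk⟩ := hx.exists_realizes
  exact ⟨k, (mem_uniserialVariety_iff hI).2 ⟨U, x, hx, hk⟩, U, rfl, x, hx, hk⟩

theorem ConditionN.exists_of_mem_uniserialVariety {k : DetourVar p → K}
    (hk : k ∈ uniserialVariety I p) :
    ∃ c ∈ uniserialTypes S, ∃ U : ModuleCat.{max u v w} (PathAlgebra K V ⧸ I),
      Quotient.mk _ U = c ∧ ∃ x : U, IsLadder I p x ∧ Realizes I k x := by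
  obtain ⟨U, x, hx, hk⟩ := (mem_uniserialVariety_iff hI).1 hk
  exact ⟨_, ⟨U, (isUniserialWithFactors_iff hN hI hS hp hm).2 (hx.isMastOf hI), rfl⟩, U, rfl, x,
    hx, hk⟩

variable {μ : ℕ} (hμ : ReturnsUpTo p μ)
include hμ

/-- A slack halyard with long stem has a coordinate with infinitely many values; being an
isomorphism invariant, it would separate infinitely many types. -/
theorem ConditionN.length_lt_of_finite (hfin : (uniserialTypes S).Finite) {d : Detour p}
    (hd : IsSlackHalyard I p d) : d.1.stem.length < μ := by
  by_contra! hle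
  obtain ⟨i, hinf⟩ := isSlackHalyard_iff.1 hd
  apply hinf
  have : Nonempty (Quotient (CategoryTheory.isIsomorphicSetoid
    (ModuleCat.{max u v w} (PathAlgebra K V ⧸ I)))) := ⟨Quotient.mk _ (S 0)⟩
  have key : ∀ t ∈ (fun k : DetourVar p → K => k ⟨d, i⟩) '' uniserialVariety I p,
      ∃ c, c ∈ uniserialTypes S ∧ ∃ k : DetourVar p → K, k ⟨d, i⟩ = t ∧
        ∃ U : ModuleCat.{max u v w} (PathAlgebra K V ⧸ I),
          Quotient.mk _ U = c ∧ ∃ x : U, IsLadder I p x ∧ Realizes I k x := by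
    rintro t ⟨k, hk, rfl⟩
    obtain ⟨c, hc, hU⟩ := hN.exists_of_mem_uniserialVariety hI hm hS hp hk
    exact ⟨c, hc, k, rfl, hU⟩
  choose! F hF hF' using key
  refine Set.Finite.of_injOn (f := F) (fun t ht => hF t ht) (fun t ht t' ht' htt => ?_) hfin
  obtain ⟨k, rfl, U, hU, x, hx, hk⟩ := hF' t ht
  obtain ⟨k', rfl, U', hU', x', hx', hk'⟩ := hF' t' ht'
  obtain ⟨f⟩ := mk_eq_mk_iff.1 ((hU.trans htt).trans hU'.symm)
  exact hk.eq_of_linearEquiv hI f hx hx' hμ hk' hle i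

/-- The long coordinates embed the types into a finite product, each factor of which is finite
because long detours are not slack halyards. -/
theorem ConditionN.finite_of_length_lt [∀ a b : V, Finite (a ⟶ b)]
    (hs : ∀ d : Detour p, IsSlackHalyard I p d → d.1.stem.length < μ) :
    (uniserialTypes S).Finite := by
  have := finite_detour (p := p)
  have key : ∀ c ∈ uniserialTypes S, ∃ k : DetourVar p → K, k ∈ uniserialVariety I p ∧
      ∃ U : ModuleCat.{max u v w} (PathAlgebra K V ⧸ I),
        Quotient.mk _ U = c ∧ ∃ x : U, IsLadder I p x ∧ Realizes I k x :=
    fun c hc => hN.exists_of_mem_uniserialTypes hI hm hS hp hc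
  choose! F hF hF' using key
  refine Set.Finite.of_injOn
    (f := fun c (t : {t : DetourVar p // μ ≤ t.1.1.stem.length}) => F c t.1)
    (t := Set.univ.pi fun t : {t : DetourVar p // μ ≤ t.1.1.stem.length} =>
      (fun k : DetourVar p → K => k t.1) '' uniserialVariety I p)
    (fun c hc t _ => ⟨F c, hF c hc, rfl⟩) (fun c hc c' hc' hcc => ?_)
    (Set.Finite.pi fun t => ?_)
  · obtain ⟨U, rfl, x, hx, hk⟩ := hF' c hc
    obtain ⟨U', rfl, x', hx', hk'⟩ := hF' c' hc'
    exact mk_eq_mk_iff.2 (hN.nonempty_linearEquiv hI hm hμ hx hx' hk hk'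
      fun d hd i => congrFun hcc ⟨⟨d, i⟩, hd⟩)
  · obtain ⟨⟨d, i⟩, ht⟩ := t
    by_contra hinf
    exact ht.not_gt (hs d (isSlackHalyard_iff.2 ⟨i, hinf⟩))

/-- A long detour is neither a slack nor a tight halyard, hence not a halyard, so its coordinates
vanish on `V_p`. All the modules then agree in their long coordinates. -/
theorem ConditionN.existsUnique_type (hne : (uniserialVariety I p).Nonempty)
    (hs : ∀ d : Detour p, IsSlackHalyard I p d → d.1.stem.length < μ)
    (ht : ∀ d : Detour p, ¬ IsTightHalyard I p d) : ∃! c, c ∈ uniserialTypes S := by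
  obtain ⟨k₀, hk₀⟩ := hne
  obtain ⟨c, hc, -⟩ := hN.exists_of_mem_uniserialVariety hI hm hS hp hk₀
  have hzero : ∀ k ∈ uniserialVariety I p, ∀ d : Detour p, μ ≤ d.1.stem.length →
      ∀ i : DetourIndex d, k ⟨d, i⟩ = 0 := by
    intro k hk d hd i
    refine coordVar_eq_zero_iff.1 ?_ k hk
    by_contra h0
    exact ht d ⟨⟨i, h0⟩, fun hsl => hd.not_gt (hs d hsl)⟩
  refine ⟨c, hc, fun c' hc' => ?_⟩
  obtain ⟨k, hkV, U, rfl, x, hx, hk⟩ := hN.exists_of_mem_uniserialTypes hI hm hS hp hc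
  obtain ⟨k', hkV', U', rfl, x', hx', hk'⟩ := hN.exists_of_mem_uniserialTypes hI hm hS hp hc'
  exact mk_eq_mk_iff.2 (hN.nonempty_linearEquiv hI hm hμ hx' hx hk' hk fun d hd i => by
    rw [hzero k hkV d hd, hzero k' hkV' d hd])

end Types

end Main

theorem theorem5p1 {K : Type u} [Field K] [Infinite K]
    {V : Type v} [Fintype V] [Quiver.{w} V] [∀ a b : V, Finite (a ⟶ b)]
    (I : Ideal (PathAlgebra K V)) [I.IsTwoSided] (hI : IsAdmissible I)
    (hN : ConditionN I)
    {l : ℕ} (S : Fin (l + 1) → ModuleCat.{max u v w} (PathAlgebra K V ⧸ I))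
    (hS : ∀ i, IsSimpleModule (PathAlgebra K V ⧸ I) (S i))
    (hV : ∃ p : QuiverPath V, PassesThrough I S p.path ∧ (uniserialVariety I p.path).Nonempty)
    (hExt : Nontrivial (CategoryTheory.Abelian.Ext.{max u v w} (S 0) (S 0) 1)) :
    (∃! p : QuiverPath V, PassesThrough I S p.path) ∧
      ∀ p : QuiverPath V, PassesThrough I S p.path →
        ((uniserialTypes S).Finite ↔ HasLoopForm I p.path) ∧
        (HasLoopForm I p.path → (∀ d : Detour p.path, ¬ IsTightHalyard I p.path d) →
          ∃! c, c ∈ uniserialTypes S) := by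
  obtain ⟨p, hp, hne⟩ := hV
  have hm : IsMast I p.path := by
    obtain ⟨k, U, hU, -⟩ := hne
    exact ⟨U, hU⟩
  have huniq (q : QuiverPath V) (hq : PassesThrough I S q.path) : q = p := by
    obtain ⟨hl, hv⟩ := passesThrough_iff.1 hp
    obtain ⟨hl', hv'⟩ := passesThrough_iff.1 hq
    -- A simple module determines its vertex, so both paths visit the same vertices; (N) leaves no
    -- choice of arrows along a mast.
    refine hN.eq_of_vtx_eq hI hm (hl'.trans hl.symm) fun i hi => ?_
    have := hS ⟨i, by omega⟩
    obtain ⟨t, ht⟩ := hv ⟨i, by omega⟩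
    obtain ⟨t', ht'⟩ := hv' ⟨i, by omega⟩
    exact eq_of_vertexClass_smul_ne_zero hI ht' ht
  obtain ⟨γ⟩ : Nonempty (p.src ⟶ p.src) := by
    obtain ⟨t, ht⟩ := (passesThrough_iff.1 hp).2 0
    rw [Fin.val_zero, vtx_zero] at ht
    have := hS 0
    exact nonempty_loop_of_nontrivial_ext hI ht hExt
  obtain ⟨μ, hμ⟩ := hN.exists_returnsUpTo hI hm γ
  refine ⟨⟨p, hp, huniq⟩, fun q hq => ?_⟩
  obtain rfl := huniq q hq
  refine ⟨⟨fun hfin => hN.hasLoopForm hI hm γ hμ fun d hd =>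
    hN.length_lt_of_finite hI hm hS hp hμ hfin hd, fun h => ?_⟩, fun h ht => ?_⟩
  · obtain ⟨μ', hμ', hs⟩ := h.exists_returnsUpTo
    exact hN.finite_of_length_lt hI hm hS hp hμ' hs
  · obtain ⟨μ', hμ', hs⟩ := h.exists_returnsUpTo
    exact hN.existsUnique_type hI hm hS hp hμ' hne hs ht
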